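/- **Setting.** A single-sink network consists of a finite directed graph $G=(V,E)$ with $E\neq\emptyset$ (parallel edges allowed), edge capacities $\nu_e>0$, edge travel times $\tau_e>0$, a sink $t\in V$ reachable from every node, and network inflow rates $u_v:\mathbb R_{\ge 0}\to\mathbb R_{\ge 0}$ for $v\ne t$ that are right-constant step functions with bounded support and finitely many jump points. Let $\delta^+_v,\delta^-_v$ be the sets of edges leaving and entering $v$. A flow over time $f=(f^+,f^-)$ consists of non-negative integrable edge in- and outflow rates $f^+_e,f^-_e$ on $\mathbb R_{\ge 0}$, with cumulative rates $F^\pm_e(\theta)=\int_0^\theta f^\pm_e$ and queue lengths $q_e(\theta)=F^+_e(\theta)-F^-_e(\theta+\tau_e)$. It is feasible if for all $\theta\ge 0$: $\sum_{e\in\delta^+_v}f^+_e(\theta)-\sum_{e\in\delta^-_v}f^-_e(\theta)=u_v(\theta)$ for $v\neq t$ (and $\le 0$ at $t$), $f^-_e(\theta)=0$ for $\theta<\tau_e$, and $f^-_e(\theta+\tau_e)$ equals $\nu_e$ if $q_e(\theta)>0$ and $\min\{f_e^+(\theta),\nu_e\}$ otherwise. Put $c_e=\tau_e+q_e/\nu_e$,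 $\ell_t=0$, and $\ell_v=\min_{e=vw\in E}(\ell_w+c_e)$ for $v\ne t$. An edge $e=vw$ is active at time $\theta$ if $\ell_v(\theta)=\ell_w(\theta)+c_e(\theta)$. A feasible flow is an instantaneous dynamic equilibrium (IDE) if $f^+_e(\theta)>0$ implies that $e$ is active at time $\theta$. It terminates by time $T\ge 0$ if there is no network inflow from time $T$ on and $F^+_e(T)=F^-_e(T)$ for all $e$. Let $b^-_v=\sum_{e\in\delta^-_v}f^-_e+u_v$ be the gross node inflow rate and $\tau_{\min}=\min_e\tau_e$. **Algorithm (acyclic $G$).** Choose $T\ge 0$ such that all IDE of the network terminate by $T$, and fix a topological order starting with $t$. For $k=0,\dots,\lfloor T/\tau_{\min}\rfloor$ and for every node $v\ne t$ in this order, distribute $b^-_v$ on $[k\tau_{\min},(k+1)\tau_{\min})$ to the active edges leaving $v$, covering this interval by (a priori possibly infinitely many) disjoint maximal local phases. A maximal local phase is an interval $[a,b)$ on which $v$ sends its inflow with constant rates $f^+_e(a)$, $e\in\delta^+_v$, where $b\le (k+1)\tau_{\min}$ is largest such that, if these rates are kept from time $a$ on, $b^-_v$ is constant on $[a,b)$,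 the used edges are active on $[a,b)$, and the set of active edges leaving $v$ does not change during $(a,b)$. The choice of the distribution at the start of each local phase is otherwise arbitrary. The phases of a flow $f$ are the maximal open intervals of $(0,\infty)$ on which all edge in- and outflow rates and the set of active edges are constant. **Proposition 3.3.** There is an absolute constant $C>0$ such that for every acyclic single-sink network and every IDE $f$ constructed by the algorithm above, $f$ has finitely many phases (their end points are finite in number), namely at most $$C\cdot P\cdot\Big(2(\Delta+1)^{4^{\Delta}+1}\Big)^{|V|\,T/\tau_{\min}},$$ where $\Delta=\max_{v\in V}|\delta^+_v|$ is the maximum out-degree and $P$ is the number of maximal intervals on which all network inflow rates are constant. If $T\ge\tau_{\min}$ (automatic unless all network inflow rates vanish), the total number of local phases carried out at all nodes and in all passes is also finite and bounded by the same expression. -/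

import Mathlib

open Filter Topology MeasureTheory Set

/-- The interior jump points of a function of time `θ ≥ 0`: the times `θ > 0` around which `g`
is not constant.  If there are only finitely many of them, they cut `(0, ∞)` into
`(number of jump points) + 1` maximal open intervals on which `g` is constant. -/
def jumpTimes {α : Type*} (g : ℝ → α) : Set ℝ :=
  {θ | 0 < θ ∧ ¬ ∀ᶠ x in 𝓝 θ, g x = g θ}

/-- A single-sink network on a directed (multi-)graph with vertex set `V` and edge set `E`.
Only times `θ ≥ 0` are meaningful.  The network inflow rates are right-constant step functions
with bounded support and finitely many jump points; there is no network inflow at the sink. -/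
structure SingleSinkNetwork (V E : Type*) where
  src : E → V
  dst : E → V
  sink : V
  cap : E → ℝ
  cap_pos : ∀ e, 0 < cap e
  transit : E → ℝ
  transit_pos : ∀ e, 0 < transit e
  inflow : V → ℝ → ℝ
  inflow_nonneg : ∀ v θ, 0 ≤ θ → 0 ≤ inflow v θ
  inflow_sink : ∀ θ, inflow sink θ = 0
  inflow_right_constant : ∀ v θ, 0 ≤ θ → ∀ᶠ x in 𝓝[≥] θ, inflow v x = inflow v θ
  inflow_finite_jumps : ∀ v, (jumpTimes (inflow v)).Finite
  inflow_bounded_support : ∀ v, ∃ M : ℝ, ∀ θ, M ≤ θ → inflow v θ = 0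
  sink_reachable : ∀ v, Relation.ReflTransGen (fun x y => ∃ e, src e = x ∧ dst e = y) v sink

/-- A flow over time: nonnegative integrable edge inflow and edge outflow rates
(only their values at times `θ ≥ 0` are meaningful). -/
structure FlowOverTime (E : Type*) where
  inRate : E → ℝ → ℝ
  outRate : E → ℝ → ℝ
  inRate_nonneg : ∀ e θ, 0 ≤ θ → 0 ≤ inRate e θ
  outRate_nonneg : ∀ e θ, 0 ≤ θ → 0 ≤ outRate e θ
  inRate_integrable : ∀ e, IntegrableOn (inRate e) (Ici 0)
  outRate_integrable : ∀ e, IntegrableOn (outRate e) (Ici 0)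

namespace FlowOverTime

variable {E : Type*}

/-- Cumulative edge inflow `F⁺_e(θ)`. -/
noncomputable def cumIn (f : FlowOverTime E) (e : E) (θ : ℝ) : ℝ :=
  ∫ ζ in (0 : ℝ)..θ, f.inRate e ζ

/-- Cumulative edge outflow `F⁻_e(θ)`. -/
noncomputable def cumOut (f : FlowOverTime E) (e : E) (θ : ℝ) : ℝ :=
  ∫ ζ in (0 : ℝ)..θ, f.outRate e ζ

end FlowOverTime

namespace SingleSinkNetwork

variable {V E : Type*}

/-- There is an edge from `x` to `y`. -/
def Adj (N : SingleSinkNetwork V E) (x y : V) : Prop :=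
  ∃ e, N.src e = x ∧ N.dst e = y

/-- The underlying directed graph has no directed cycle. -/
def Acyclic (N : SingleSinkNetwork V E) : Prop :=
  ∀ v, ¬ Relation.TransGen N.Adj v v

open Classical in
/-- The edges leaving `v`. -/
noncomputable def outEdges [Fintype E] (N : SingleSinkNetwork V E) (v : V) : Finset E :=
  Finset.univ.filter (fun e => N.src e = v)

open Classical in
/-- The edges entering `v`. -/
noncomputable def inEdges [Fintype E] (N : SingleSinkNetwork V E) (v : V) : Finset E :=
  Finset.univ.filter (fun e => N.dst e = v)

/-- The maximum out-degree `Δ`. -/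
noncomputable def maxOutDegree [Fintype V] [Fintype E] (N : SingleSinkNetwork V E) : ℕ :=
  Finset.univ.sup (fun v => (N.outEdges v).card)

/-- The smallest edge travel time `τ_min`. -/
noncomputable def tauMin [Fintype E] [Nonempty E] (N : SingleSinkNetwork V E) : ℝ :=
  Finset.univ.inf' Finset.univ_nonempty N.transit

/-- The number `P` of maximal intervals on which all network inflow rates are constant. -/
noncomputable def numInflowIntervals (N : SingleSinkNetwork V E) : ℕ :=
  (jumpTimes (fun θ v => N.inflow v θ)).ncard + 1

/-- The queue length `q_e(θ) = F⁺_e(θ) - F⁻_e(θ + τ_e)`. -/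
noncomputable def queue (N : SingleSinkNetwork V E) (f : FlowOverTime E) (e : E) (θ : ℝ) : ℝ :=
  f.cumIn e θ - f.cumOut e (θ + N.transit e)

/-- The instantaneous travel time `c_e(θ) = τ_e + q_e(θ) / ν_e`. -/
noncomputable def cost (N : SingleSinkNetwork V E) (f : FlowOverTime E) (e : E) (θ : ℝ) : ℝ :=
  N.transit e + N.queue f e θ / N.cap e

/-- Feasible flows over time: flow conservation at the nodes other than the sink, no net outflow
at the sink, no edge outflow before the travel time has elapsed, queues operate at capacity. -/
structure IsFeasible [Fintype E] (N : SingleSinkNetwork V E) (f : FlowOverTime E) : Prop where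
  conservation : ∀ v, v ≠ N.sink → ∀ θ, 0 ≤ θ →
    ∑ e ∈ N.outEdges v, f.inRate e θ - ∑ e ∈ N.inEdges v, f.outRate e θ = N.inflow v θ
  conservation_sink : ∀ θ, 0 ≤ θ →
    ∑ e ∈ N.outEdges N.sink, f.inRate e θ - ∑ e ∈ N.inEdges N.sink, f.outRate e θ ≤ 0
  no_early_outflow : ∀ e θ, 0 ≤ θ → θ < N.transit e → f.outRate e θ = 0
  at_capacity_of_queue : ∀ e θ, 0 ≤ θ → 0 < N.queue f e θ →
    f.outRate e (θ + N.transit e) = N.cap e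
  at_capacity_of_no_queue : ∀ e θ, 0 ≤ θ → N.queue f e θ ≤ 0 →
    f.outRate e (θ + N.transit e) = min (f.inRate e θ) (N.cap e)

/-- `ℓ` satisfies, for the edge costs `c`, the equations of the distance labels:
`ℓ_t = 0` at the sink and `ℓ_v = min {ℓ_w + c_e | e = vw}` at every other node. -/
def IsLabelling (N : SingleSinkNetwork V E) (c : E → ℝ) (ℓ : V → ℝ) : Prop :=
  ℓ N.sink = 0 ∧
    ∀ v, v ≠ N.sink → IsLeast {x | ∃ e, N.src e = v ∧ x = ℓ (N.dst e) + c e} (ℓ v)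

/-- In an acyclic network the equations of the distance labels have exactly one solution. -/
theorem existsUnique_labelling [Finite V] [Finite E] (N : SingleSinkNetwork V E)
    (hN : N.Acyclic) (c : E → ℝ) : ∃! ℓ : V → ℝ, N.IsLabelling c ℓ := by
  classical
  have wf : WellFounded (fun w v : V => Relation.TransGen N.Adj v w) := by
    have : IsTrans V (fun w v : V => Relation.TransGen N.Adj v w) :=
      ⟨fun a b d h1 h2 => h2.trans h1⟩
    have : Std.Irrefl (fun w v : V => Relation.TransGen N.Adj v w) := ⟨fun a h => hN a h⟩
    exact Finite.wellFounded_of_trans_of_irrefl _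
  have hne : ∀ v, v ≠ N.sink → ∃ e, N.src e = v := by
    intro v hv
    rcases Relation.ReflTransGen.cases_head (N.sink_reachable v) with h | ⟨w, ⟨e, he, _⟩, _⟩
    · exact absurd h hv
    · exact ⟨e, he⟩
  let S : (V → ℝ) → V → Set ℝ := fun ℓ v => {x | ∃ e, N.src e = v ∧ x = ℓ (N.dst e) + c e}
  have hfin : ∀ ℓ v, (S ℓ v).Finite := by
    intro ℓ v
    refine (Set.finite_range (fun e => ℓ (N.dst e) + c e)).subset ?_
    rintro x ⟨e, _, rfl⟩
    exact ⟨e, rfl⟩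
  let F : (v : V) → ((w : V) → Relation.TransGen N.Adj v w → ℝ) → ℝ := fun v r =>
    if v = N.sink then 0
    else sInf {x | ∃ (e : E) (he : N.src e = v),
      x = r (N.dst e) (Relation.TransGen.single ⟨e, he, rfl⟩) + c e}
  let ℓ : V → ℝ := wf.fix F
  have hℓ : ∀ v, ℓ v = if v = N.sink then 0 else sInf (S ℓ v) := by
    intro v
    have h1 : ℓ v = F v (fun w _ => ℓ w) := wf.fix_eq F v
    rw [h1]
    by_cases hv : v = N.sink
    · simp [F, hv]
    · simp only [F, S, hv, if_false]
      congr 1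
      ext x
      simp only [Set.mem_ofPred_eq, exists_prop]
  refine ⟨ℓ, ⟨?_, ?_⟩, ?_⟩
  · rw [hℓ]; simp
  · intro v hv
    have hnon : (S ℓ v).Nonempty := by
      obtain ⟨e, he⟩ := hne v hv
      exact ⟨_, e, he, rfl⟩
    have h2 := hℓ v
    rw [if_neg hv] at h2
    rw [h2]
    exact ⟨hnon.csInf_mem (hfin ℓ v), fun x hx => csInf_le (hfin ℓ v).bddBelow hx⟩
  · intro m hm
    funext v
    induction v using wf.induction with
    | _ v ih =>
      by_cases hv : v = N.sink
      · subst hv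
        rw [hm.1, hℓ]; simp
      · have hS : S m v = S ℓ v := by
          ext x
          constructor
          · rintro ⟨e, he, rfl⟩
            exact ⟨e, he, by rw [ih _ (Relation.TransGen.single ⟨e, he, rfl⟩)]⟩
          · rintro ⟨e, he, rfl⟩
            exact ⟨e, he, by rw [ih _ (Relation.TransGen.single ⟨e, he, rfl⟩)]⟩
        have h3 : m v = sInf (S m v) := (hm.2 v hv).csInf_eq.symm
        rw [h3, hS, hℓ v, if_neg hv]

open Classical in
/-- The node labels `ℓ_v(θ)`: the solution of the label equations for the costs `c_e(θ)`. -/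
noncomputable def label (N : SingleSinkNetwork V E) (f : FlowOverTime E) (v : V) (θ : ℝ) : ℝ :=
  if h : ∃ ℓ : V → ℝ, N.IsLabelling (fun e => N.cost f e θ) ℓ then h.choose v else 0

/-- The set `E_θ` of edges `e = vw` that are active at time `θ`: `ℓ_v(θ) = ℓ_w(θ) + c_e(θ)`. -/
def activeEdges (N : SingleSinkNetwork V E) (f : FlowOverTime E) (θ : ℝ) : Set E :=
  {e | N.label f (N.src e) θ = N.label f (N.dst e) θ + N.cost f e θ}

/-- Instantaneous dynamic equilibria: feasible flows that only ever enter active edges. -/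
def IsIDE [Fintype E] (N : SingleSinkNetwork V E) (f : FlowOverTime E) : Prop :=
  N.IsFeasible f ∧ ∀ θ, 0 ≤ θ → ∀ e, 0 < f.inRate e θ → e ∈ N.activeEdges f θ

/-- All flow particles have reached the sink by time `T`: no particle enters the network at or
after time `T`, and no particle is on an edge (in its queue or travelling) at time `T`. -/
def TerminatesBy (N : SingleSinkNetwork V E) (f : FlowOverTime E) (T : ℝ) : Prop :=
  (∀ v θ, T ≤ θ → N.inflow v θ = 0) ∧ ∀ e, f.cumIn e T = f.cumOut e T

/-- The times at which a phase of the flow `f` ends and the next one starts: some edge inflow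
rate, some edge outflow rate or the set of active edges changes.  (If none of these changes, then
the gross node inflow rates do not change either.) -/
def phaseTimes (N : SingleSinkNetwork V E) (f : FlowOverTime E) : Set ℝ :=
  jumpTimes (fun θ => ((fun e => f.inRate e θ), (fun e => f.outRate e θ), N.activeEdges f θ))

/-- The number of phases of `f` (meaningful if `phaseTimes` is finite). -/
noncomputable def numPhases (N : SingleSinkNetwork V E) (f : FlowOverTime E) : ℕ :=
  (N.phaseTimes f).ncard + 1

/-- The gross node inflow rate `b⁻_v(θ)`. -/
noncomputable def grossInflow [Fintype E] (N : SingleSinkNetwork V E) (f : FlowOverTime E)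
    (v : V) (θ : ℝ) : ℝ :=
  ∑ e ∈ N.inEdges v, f.outRate e θ + N.inflow v θ

/-- The queue length on `e` at time `θ ≥ a` if from time `a` on the edge is entered at the constant
rate `f⁺_e(a)`: the queue grows or shrinks at rate `f⁺_e(a) - ν_e`, but stays empty once it has
run empty. -/
noncomputable def projQueue (N : SingleSinkNetwork V E) (f : FlowOverTime E) (e : E)
    (a θ : ℝ) : ℝ :=
  max 0 (N.queue f e a + (f.inRate e a - N.cap e) * (θ - a))

/-- The current travel time to the sink through `e = vw` at time `θ ≥ a` under the constant
inflow rate `f⁺_e(a)` into `e` from time `a` on. -/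
noncomputable def projTime (N : SingleSinkNetwork V E) (f : FlowOverTime E) (e : E)
    (a θ : ℝ) : ℝ :=
  N.label f (N.dst e) θ + (N.transit e + N.projQueue f e a θ / N.cap e)

/-- The edges leaving `v` that are active at time `θ ≥ a` if from time `a` on the node `v` uses the
constant flow distribution `(f⁺_e(a))_e`.  (In an acyclic network the labels of the heads of these
edges do not depend on the flow sent into edges leaving `v`.) -/
def projActive (N : SingleSinkNetwork V E) (f : FlowOverTime E) (v : V) (a θ : ℝ) : Set E :=
  {e | N.src e = v ∧ ∀ e', N.src e' = v → N.projTime f e a θ ≤ N.projTime f e' a θ}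

/-- The distribution `(f⁺_e(a))_e` that `v` uses at time `a` can be kept on the whole proper
interval `[a, b)` without an event at `v`: the gross node inflow rate of `v` is constant, the used
edges are active, and the set of active edges leaving `v` does not change during `(a, b)`. -/
structure CanKeepDistribution [Fintype E] (N : SingleSinkNetwork V E) (f : FlowOverTime E)
    (v : V) (a b : ℝ) : Prop where
  proper : a < b
  gross_const : ∀ θ ∈ Ico a b, N.grossInflow f v θ = N.grossInflow f v a
  used_active : ∀ e, N.src e = v → 0 < f.inRate e a → ∀ θ ∈ Ico a b, e ∈ N.projActive f v a θ
  active_const : ∀ θ ∈ Ioo a b, ∀ θ' ∈ Ioo a b, N.projActive f v a θ = N.projActive f v a θ'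

/-- `[a, b)` is a local phase of `f` at `v` which is maximal before time `h`: `v` uses one constant
flow distribution on `[a, b)`, and `b` is the largest time up to `h` until which this distribution
can be kept without an event at `v`. -/
structure IsMaximalLocalPhase [Fintype E] (N : SingleSinkNetwork V E) (f : FlowOverTime E)
    (v : V) (h a b : ℝ) : Prop where
  can_keep : N.CanKeepDistribution f v a b
  le_end : b ≤ h
  inRate_const : ∀ e, N.src e = v → ∀ θ ∈ Ico a b, f.inRate e θ = f.inRate e a
  maximal : ∀ b', b < b' → b' ≤ h → ¬ N.CanKeepDistribution f v a b'

/-- The index `⌊T / τ_min⌋` of the last pass of the outer loop. -/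
noncomputable def lastPass [Fintype E] [Nonempty E] (N : SingleSinkNetwork V E) (T : ℝ) : ℕ :=
  ⌊T / N.tauMin⌋₊

/-- A run of the construction algorithm for acyclic networks with time horizon `T`.
All IDE of the network terminate by time `T`.  With respect to a fixed topological order starting
with the sink, pass `k = 0, …, ⌊T / τ_min⌋` goes through the nodes `v ≠ t` and distributes the gross
node inflow of `v` during `[k τ_min, (k+1) τ_min)` to the edges leaving `v`, by covering this
interval with maximal local phases; `phases v k` is the set of pairs `(a, b)` for which `[a, b)` is
one of them.  It is not required that finitely many local phases suffice.  Every condition on the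
rates chosen at `v` in pass `k` involves only what was computed earlier in the run.
The constructed flow `flow` is an IDE (with no particles left after the last pass). -/
structure AcyclicRun [Fintype V] [Fintype E] [Nonempty E] (N : SingleSinkNetwork V E)
    (T : ℝ) where
  horizon_nonneg : 0 ≤ T
  horizon_large : ∀ g : FlowOverTime E, N.IsIDE g → N.TerminatesBy g T
  order : V ≃ Fin (Fintype.card V)
  order_sink : (order N.sink : ℕ) = 0
  order_topological : ∀ e, order (N.dst e) < order (N.src e)
  flow : FlowOverTime E
  isIDE : N.IsIDE flow
  phases : V → ℕ → Set (ℝ × ℝ)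
  phases_start : ∀ v, v ≠ N.sink → ∀ k, k ≤ N.lastPass T → ∀ I ∈ phases v k,
    (k : ℝ) * N.tauMin ≤ I.1
  phases_maximal : ∀ v, v ≠ N.sink → ∀ k, k ≤ N.lastPass T → ∀ I ∈ phases v k,
    N.IsMaximalLocalPhase flow v (((k : ℝ) + 1) * N.tauMin) I.1 I.2
  phases_cover : ∀ v, v ≠ N.sink → ∀ k, k ≤ N.lastPass T →
    ∀ θ ∈ Ico ((k : ℝ) * N.tauMin) (((k : ℝ) + 1) * N.tauMin),
      ∃! I : ℝ × ℝ, I ∈ phases v k ∧ θ ∈ Ico I.1 I.2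

/-- All local phases `(v, k, a, b)` that are carried out during a run. -/
def AcyclicRun.localPhases [Fintype V] [Fintype E] [Nonempty E] {N : SingleSinkNetwork V E}
    {T : ℝ} (R : N.AcyclicRun T) : Set (V × ℕ × ℝ × ℝ) :=
  {x | x.1 ≠ N.sink ∧ x.2.1 ≤ N.lastPass T ∧ x.2.2 ∈ R.phases x.1 x.2.1}

end SingleSinkNetwork

/-! Local part. Consider a node with `d` outgoing edges during an interval on which its gross inflow
is constant and the labels of the heads are affine. Inside the interval, a local phase ends only
because an edge becomes active or the queue of an active edge runs empty
(`IsMaximalLocalPhase.event`). To count such events, let `σ i` bound the slope of the travel time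
through edge `i` while nothing enters it, and let `j` maximise `σ` among the edges that may be
active. If the slope of the node label jumped from at most `σ j` to above `σ j`, every active edge
would need more inflow than just before, although the total is constant
(`NodeDynamics.labelSlope_le_of_le`). So an early part with label slope above `σ j` is followed by a
late part with slope at most `σ j`. In the early part no edge leaves the active set, and at most `d`
phases start. In the late part the queue of `j` cannot grow, so it is first positive and then empty;
once one of these two cases is fixed, `j` is first active, with at most `d` phase starts, and then
inactive for good. Each edge passes through two such stages, so a binary recursion of depth `2 * d`
yields at most `2 * d * 4 ^ d` phases (`NodeDynamics.HasEvents.encard_le`).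

Global part. A finite set `X` of break points is maintained, away from which everything computed so
far is regular. It cuts a pass at a node into at most `X.card + 1` intervals of the above kind: the
heads of the edges are processed earlier, and the outflow of incoming edges is known one travel time
ahead. Each new local phase adds boundedly many break points (`RegularUpTo.step`), so the count of
break points and phases grows by a bounded factor per node and pass (`AcyclicRun.stageBound_succ`).
In the last pass no flow is left to distribute, since it would arrive after `T`; hence only `⌊T /
τ_min⌋` passes enter the exponent. -/

theorem antitoneOn_of_eventually_le {g : ℝ → ℝ} {I : Set ℝ} (hI : I.OrdConnected)
    (hc : ContinuousOn g I)
    (h : ∀ x ∈ I, ∀ y ∈ I, x < y → ∀ᶠ z in 𝓝[>] x, g z ≤ g x) : AntitoneOn g I := by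
  intro a ha b hb hab
  have hsub : Icc a b ⊆ I := hI.out ha hb
  have hcl : IsClosed ({x | g x ≤ g a} ∩ Icc a b) := by
    have := isClosed_Icc.isClosed_le (hc.mono hsub) (continuousOn_const (c := g a))
    convert this using 1
    ext x; simp [and_comm]
  -- Continuous induction along `[a, b]`; the last point of `I`, if any, needs no hypothesis.
  refine hcl.Icc_subset_of_forall_exists_gt (le_refl (g a)) ?_ ⟨hab, le_rfl⟩
  rintro x ⟨hx, hx1, hx2⟩ y hy
  have h1 := h x (hsub ⟨hx1, hx2.le⟩) b hb hx2
  have h2 : ∀ᶠ z in 𝓝[>] x, z ∈ Ioc x y := Ioc_mem_nhdsGT hy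
  obtain ⟨z, hz1, hz2⟩ := (h1.and h2).exists
  exact ⟨z, hz1.trans hx, hz2⟩

/-- The evolution of the queues on the edges leaving a node while the gross inflow rate of the node
is constant and the labels of the heads of the edges are affine with slopes `base`. -/
structure NodeDynamics (ι : Type*) [Fintype ι] where
  dom : Set ℝ
  dom_ordConnected : dom.OrdConnected
  cap : ι → ℝ
  cap_pos : ∀ i, 0 < cap i
  base : ι → ℝ
  gross : ℝ
  rate : ι → ℝ → ℝ
  queue : ι → ℝ → ℝ
  time : ι → ℝ → ℝ
  label : ℝ → ℝ
  labelSlope : ℝ → ℝ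
  rate_nonneg : ∀ i, ∀ θ ∈ dom, 0 ≤ rate i θ
  sum_rate : ∀ θ ∈ dom, ∑ i, rate i θ = gross
  queue_nonneg : ∀ i, ∀ θ ∈ dom, 0 ≤ queue i θ
  label_le : ∀ i, ∀ θ ∈ dom, label θ ≤ time i θ
  exists_active : ∀ θ ∈ dom, ∃ i, time i θ = label θ
  active_of_rate_pos : ∀ i, ∀ θ ∈ dom, 0 < rate i θ → time i θ = label θ
  queue_cont : ∀ i, ContinuousOn (queue i) dom
  time_cont : ∀ i, ContinuousOn (time i) dom
  label_cont : ContinuousOn label dom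
  -- Only germs to the right are available: a priori, infinitely many phases may accumulate from the
  -- left at some time.
  rate_germ : ∀ i, ∀ θ ∈ dom, ∀ᶠ y in 𝓝[>] θ, rate i y = rate i θ
  labelSlope_germ : ∀ θ ∈ dom, ∀ᶠ y in 𝓝[>] θ, labelSlope y = labelSlope θ
  label_germ : ∀ θ ∈ dom, ∀ᶠ y in 𝓝[>] θ, label y = label θ + labelSlope θ * (y - θ)
  queue_germ : ∀ i, ∀ θ ∈ dom, ∀ᶠ y in 𝓝[>] θ, queue i y = queue i θ +
    cap i * (if 0 < queue i θ then rate i θ / cap i - 1 else max (rate i θ / cap i - 1) 0) * (y - θ)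
  time_germ : ∀ i, ∀ θ ∈ dom, ∀ᶠ y in 𝓝[>] θ, time i y = time i θ +
    (base i + if 0 < queue i θ then rate i θ / cap i - 1 else max (rate i θ / cap i - 1) 0) * (y - θ)

/-! ### Slopes of travel times and labels at one node -/

namespace NodeDynamics

variable {ι : Type*} [Fintype ι] (D : NodeDynamics ι)

/-- The growth rate of the queueing delay. -/
noncomputable def delaySlope (i : ι) (θ : ℝ) : ℝ :=
  if 0 < D.queue i θ then D.rate i θ / D.cap i - 1 else max (D.rate i θ / D.cap i - 1) 0

/-- The edge `i` is active at time `θ`. -/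
def Active (i : ι) (θ : ℝ) : Prop := D.time i θ = D.label θ

variable {D}

theorem eventually_mem_dom {θ θ' : ℝ} (hθ : θ ∈ D.dom) (hθ' : θ' ∈ D.dom) (h : θ < θ') :
    ∀ᶠ y in 𝓝[>] θ, y ∈ D.dom := by
  filter_upwards [Ioo_mem_nhdsGT h] with y hy
  exact D.dom_ordConnected.out hθ hθ' ⟨hy.1.le, hy.2.le⟩

theorem labelSlope_le {θ θ' : ℝ} (hθ : θ ∈ D.dom) (hθ' : θ' ∈ D.dom) (h : θ < θ') {i : ι}
    (hi : D.Active i θ) : D.labelSlope θ ≤ D.base i + D.delaySlope i θ := by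
  obtain ⟨y, ⟨⟨h1, h2⟩, h3⟩, h4⟩ := ((((D.time_germ i θ hθ).and (D.label_germ θ hθ)).and
    (eventually_mem_dom hθ hθ' h)).and self_mem_nhdsWithin).exists
  have h5 := D.label_le i y h3
  rw [h1, h2, hi] at h5
  have h6 : 0 < y - θ := sub_pos.2 h4
  refine le_of_mul_le_mul_right (a := y - θ) ?_ h6
  unfold delaySlope
  linarith

theorem eventually_active_of_rate_pos {θ θ' : ℝ} (hθ : θ ∈ D.dom) (hθ' : θ' ∈ D.dom)
    (h : θ < θ') {i : ι} (hi : 0 < D.rate i θ) : ∀ᶠ y in 𝓝[>] θ, D.Active i y := by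
  filter_upwards [D.rate_germ i θ hθ, eventually_mem_dom hθ hθ' h] with y h1 h2
  exact D.active_of_rate_pos i y h2 (h1 ▸ hi)

theorem slope_eq_of_eventually_active {θ : ℝ} (hθ : θ ∈ D.dom) {i : ι} (h0 : D.Active i θ)
    (hi : ∃ᶠ y in 𝓝[>] θ, D.Active i y) :
    D.base i + D.delaySlope i θ = D.labelSlope θ := by
  obtain ⟨y, h0', ⟨h1, h2⟩, h4⟩ := (hi.and_eventually (((D.time_germ i θ hθ).and
    (D.label_germ θ hθ)).and self_mem_nhdsWithin)).exists
  have h6 : 0 < y - θ := sub_pos.2 h4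
  unfold Active at h0' h0
  rw [h1, h2, h0] at h0'
  exact mul_right_cancel₀ h6.ne' (add_left_cancel h0')

theorem slope_eq_of_rate_pos {θ θ' : ℝ} (hθ : θ ∈ D.dom) (hθ' : θ' ∈ D.dom)
    (h : θ < θ') {i : ι} (hi : 0 < D.rate i θ) :
    D.base i + D.delaySlope i θ = D.labelSlope θ :=
  slope_eq_of_eventually_active hθ (D.active_of_rate_pos i θ hθ hi)
    (eventually_active_of_rate_pos hθ hθ' h hi).frequently

theorem delaySlope_nonpos_of_rate_eq_zero {θ : ℝ} {i : ι} (h : D.rate i θ = 0) :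
    D.delaySlope i θ ≤ 0 := by
  unfold delaySlope
  rw [h]; split_ifs <;> norm_num

theorem le_delaySlope (i : ι) (θ : ℝ) : D.rate i θ / D.cap i - 1 ≤ D.delaySlope i θ := by
  unfold delaySlope
  split_ifs
  · exact le_rfl
  · exact le_max_left _ _

variable (D) in
/-- `w` and `σ` describe what is known about the edges during `I`.  Weight `0`: never active.
Weight `1`: the queue is always positive or always empty.  Weight `2`: no information.
While no flow enters an edge, its travel time has slope at most `σ`. -/
structure Status (I : Set ℝ) (w : ι → ℕ) (σ : ι → ℝ) : Prop where
  inactive : ∀ i, w i = 0 → ∀ θ ∈ I, ¬ D.Active i θ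
  -- An edge without inflow has slope `base` if its queue is empty, and `base - 1` while a positive
  -- queue drains at full capacity; `base` is an upper bound in both cases.
  settled : ∀ i, w i = 1 → (σ i = D.base i ∧ ∀ θ ∈ I, D.queue i θ = 0) ∨
    (σ i = D.base i - 1 ∧ ∀ θ ∈ I, 0 < D.queue i θ)
  free : ∀ i, w i ≠ 0 → w i ≠ 1 → σ i = D.base i

namespace Status

variable {I : Set ℝ} {w : ι → ℕ} {σ : ι → ℝ}

theorem mono {J : Set ℝ} (h : D.Status I w σ) (hJ : J ⊆ I) : D.Status J w σ where
  inactive i hi θ hθ := h.inactive i hi θ (hJ hθ)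
  settled i hi := (h.settled i hi).imp (fun h => ⟨h.1, fun θ hθ => h.2 θ (hJ hθ)⟩)
    (fun h => ⟨h.1, fun θ hθ => h.2 θ (hJ hθ)⟩)
  free := h.free

theorem weight_ne_zero (h : D.Status I w σ) {i : ι} {θ : ℝ} (hθ : θ ∈ I) (hi : D.Active i θ) :
    w i ≠ 0 := fun h0 => h.inactive i h0 θ hθ hi

theorem slope_le_of_rate_eq_zero (h : D.Status I w σ) {i : ι} (hi : w i ≠ 0) {θ : ℝ} (hθ : θ ∈ I)
    (h0 : D.rate i θ = 0) : D.base i + D.delaySlope i θ ≤ σ i := by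
  by_cases h1 : w i = 1
  · rcases h.settled i h1 with ⟨h2, h3⟩ | ⟨h2, h3⟩
    · have := delaySlope_nonpos_of_rate_eq_zero h0
      linarith
    · have := h3 θ hθ
      rw [h2, delaySlope, if_pos this, h0]; simp
  · have := delaySlope_nonpos_of_rate_eq_zero h0
    rw [h.free i hi h1]; linarith

/-- With the queue regime fixed, inflow can only raise the slope above its value at zero inflow.
This fails for weight `2`, where `σ i` is `base` but a draining queue has a smaller slope. -/
theorem le_slope_of_settled (h : D.Status I w σ) {i : ι} (hi : w i = 1) {θ : ℝ} (hθ : θ ∈ I)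
    (hr : 0 ≤ D.rate i θ) : σ i ≤ D.base i + D.delaySlope i θ := by
  have hq : 0 ≤ D.rate i θ / D.cap i := div_nonneg hr (D.cap_pos i).le
  rcases h.settled i hi with ⟨h2, h3⟩ | ⟨h2, h3⟩
  · rw [h2, delaySlope, if_neg (by simp [h3 θ hθ])]
    linarith [le_max_right (D.rate i θ / D.cap i - 1) 0]
  · rw [h2, delaySlope, if_pos (h3 θ hθ)]
    linarith

/-- At weight `1` both times obey the same queue regime, in which the slope is monotone in the rate.
At weight `2` the slope at `θ'` exceeds `base`, so there the delay slope is `rate / cap - 1`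
whatever the queue is, while at `θ` this expression is still a lower bound. -/
theorem rate_lt_rate (h : D.Status I w σ) {i : ι} (hi : w i ≠ 0) {θ θ' : ℝ} (hθ : θ ∈ I)
    (hθ' : θ' ∈ I) (h1 : σ i < D.base i + D.delaySlope i θ')
    (h2 : D.delaySlope i θ < D.delaySlope i θ') : D.rate i θ < D.rate i θ' := by
  suffices D.rate i θ / D.cap i < D.rate i θ' / D.cap i from
    (div_lt_div_iff_of_pos_right (D.cap_pos i)).1 this
  by_contra hcon
  push Not at hcon
  by_cases hw : w i = 1
  · rcases h.settled i hw with ⟨_, h3⟩ | ⟨_, h3⟩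
    · have e1 := h3 θ hθ
      have e2 := h3 θ' hθ'
      rw [delaySlope, delaySlope, if_neg (by simp [e1]), if_neg (by simp [e2])] at h2
      have : max (D.rate i θ' / D.cap i - 1) 0 ≤ max (D.rate i θ / D.cap i - 1) 0 :=
        max_le_max (by linarith) le_rfl
      linarith
    · rw [delaySlope, delaySlope, if_pos (h3 θ hθ), if_pos (h3 θ' hθ')] at h2
      linarith
  · rw [h.free i hi hw] at h1
    have h4 : 0 < D.delaySlope i θ' := by linarith
    have h5 : D.delaySlope i θ' = D.rate i θ' / D.cap i - 1 := by
      unfold delaySlope at h4 ⊢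
      split_ifs with hq
      · rfl
      · rw [if_neg hq] at h4
        rcases lt_max_iff.1 h4 with h6 | h6
        · exact max_eq_left h6.le
        · exact absurd h6 (lt_irrefl _)
    have := D.le_delaySlope i θ
    linarith

end Status

/-- Being inactive is an open condition, by continuity of travel times and label. Points to the left
of `θ` are included, which is where the lemma is needed. -/
theorem eventually_active_imp_active {I : Set ℝ} (hI : I ⊆ D.dom) {θ : ℝ} (hθ : θ ∈ I) :
    ∀ᶠ y in 𝓝[I] θ, ∀ i, D.Active i y → D.Active i θ := by
  rw [eventually_all]
  intro i
  by_cases h : D.Active i θ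
  · exact Eventually.of_forall fun _ _ => h
  · have h1 : D.label θ < D.time i θ := lt_of_le_of_ne (D.label_le i θ (hI hθ)) (Ne.symm h)
    have h2 := ((D.label_cont.mono hI) θ hθ).eventually_lt ((D.time_cont i).mono hI θ hθ) h1
    filter_upwards [h2] with y hy hy'
    exact absurd hy' hy.ne'

/-- Once the slope of the label is at most `P`, it never exceeds `P` again. -/
theorem labelSlope_le_of_le {I : Set ℝ} (hI : I.OrdConnected) (hID : I ⊆ D.dom) {w : ι → ℕ}
    {σ : ι → ℝ} (hs : D.Status I w σ) {P : ℝ} (hP : ∀ i, w i ≠ 0 → σ i ≤ P) {a b θ' : ℝ}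
    (ha : a ∈ I) (hb : b ∈ I) (hb' : θ' ∈ D.dom) (hbt : b < θ') (hab : a ≤ b)
    (h : D.labelSlope a ≤ P) :
    D.labelSlope b ≤ P := by
  have hsub : Icc a b ⊆ I := hI.out ha hb
  have hcl : IsClosed ({x | D.labelSlope x ≤ P} ∩ Icc a b) := by
    rw [← isOpen_compl_iff, isOpen_iff_mem_nhds]
    intro x hx
    by_cases hxI : x ∈ Icc a b
    swap
    · filter_upwards [isClosed_Icc.isOpen_compl.mem_nhds hxI] with y hy hy'
      exact hy hy'.2
    have hxP : P < D.labelSlope x := by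
      by_contra hcon
      exact hx ⟨not_lt.1 hcon, hxI⟩
    have hxd : x ∈ D.dom := hID (hsub hxI)
    have hxt : x < θ' := lt_of_le_of_lt hxI.2 hbt
    have hright : ∀ᶠ y in 𝓝[>] x, P < D.labelSlope y := by
      filter_upwards [D.labelSlope_germ x hxd] with y hy
      rwa [hy]
    have hact := eventually_active_imp_active hID (hsub hxI)
    -- Suppose the slope is at most `P` at some `y` just before `x`. At `x` all active edges have
    -- slope above `P`, hence above `σ`, so all of them receive inflow. Every edge used at `y` is
    -- still active at `x` and has a larger slope there, hence a larger rate. The total rate would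
    -- strictly increase between `y` and `x`.
    have hleft : ∀ᶠ y in 𝓝[<] x, y ∈ Icc a b → P < D.labelSlope y := by
      have h1 : ∀ᶠ y in 𝓝[Icc a b] x, ∀ i, D.Active i y → D.Active i x :=
        nhdsWithin_mono x hsub hact
      rw [eventually_nhdsWithin_iff] at h1
      filter_upwards [h1.filter_mono nhdsWithin_le_nhds] with y hy hyI
      have hact' := hy hyI
      have hyd : y ∈ D.dom := hID (hsub hyI)
      have hyt : y < θ' := lt_of_le_of_lt hyI.2 hbt
      by_contra hcon
      push Not at hcon
      have key : ∀ i, D.Active i x → σ i < D.base i + D.delaySlope i x := fun i hi =>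
        lt_of_le_of_lt (hP i (hs.weight_ne_zero (hsub hxI) hi))
          (hxP.trans_le (labelSlope_le hxd hb' hxt hi))
      have hpos : ∀ i, D.Active i x → 0 < D.rate i x := by
        intro i hi
        refine lt_of_le_of_ne (D.rate_nonneg i x hxd) fun h0 => ?_
        have := hs.slope_le_of_rate_eq_zero (hs.weight_ne_zero (hsub hxI) hi) (hsub hxI) h0.symm
        linarith [key i hi]
      have hle : ∀ i, 0 < D.rate i y → D.rate i y < D.rate i x := by
        intro i hi
        have hix := hact' i (D.active_of_rate_pos i y hyd hi)
        refine hs.rate_lt_rate (hs.weight_ne_zero (hsub hxI) hix) (hsub hyI) (hsub hxI)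
          (key i hix) ?_
        have e1 := slope_eq_of_rate_pos hyd hb' hyt hi
        have e2 := labelSlope_le hxd hb' hxt hix
        linarith
      have hle' : ∀ i, D.rate i y ≤ D.rate i x := by
        intro i
        rcases (D.rate_nonneg i y hyd).eq_or_lt with h0 | h0
        · rw [← h0]; exact D.rate_nonneg i x hxd
        · exact (hle i h0).le
      obtain ⟨i, hi⟩ := D.exists_active x hxd
      have hlt : ∑ i, D.rate i y < ∑ i, D.rate i x := by
        refine Finset.sum_lt_sum (fun i _ => hle' i) ⟨i, Finset.mem_univ i, ?_⟩
        rcases (D.rate_nonneg i y hyd).eq_or_lt with h0 | h0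
        · rw [← h0]; exact hpos i hi
        · exact hle i h0
      rw [D.sum_rate y hyd, D.sum_rate x hxd] at hlt
      exact lt_irrefl _ hlt
    have hall : ∀ᶠ y in 𝓝 x, y ∈ Icc a b → P < D.labelSlope y := by
      have h3 : ∀ᶠ y in 𝓝[≠] x, y ∈ Icc a b → P < D.labelSlope y := by
        rw [← Iio_union_Ioi, nhdsWithin_union]
        exact eventually_sup.2 ⟨hleft, hright.mono fun y hy _ => hy⟩
      rw [eventually_nhdsWithin_iff] at h3
      filter_upwards [h3] with y hy hyI
      by_cases hyx : y = x
      · rw [hyx]; exact hxP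
      · exact hy hyx hyI
    filter_upwards [hall] with y hy hy'
    exact absurd hy'.1 (not_le.2 (hy hy'.2))
  refine hcl.Icc_subset_of_forall_exists_gt h ?_ ⟨hab, le_rfl⟩
  rintro x ⟨hx, hx1, hx2⟩ y hy
  obtain ⟨z, hz1, hz2⟩ := ((D.labelSlope_germ x (hID (hsub ⟨hx1, hx2.le⟩))).and
    (Ioc_mem_nhdsGT hy)).exists
  exact ⟨z, by rw [mem_ofPred_eq, hz1]; exact hx, hz2⟩

variable (D) in
/-- Between two times of `S`, an edge becomes active or the queue of an active edge runs empty. -/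
def HasEvents (S : Set ℝ) : Prop :=
  ∀ a ∈ S, ∀ a' ∈ S, a ∈ D.dom → a' ∈ D.dom → a < a' →
    (∃ i c b, a < c ∧ c < b ∧ b ≤ a' ∧ ¬ D.Active i c ∧ D.Active i b) ∨
    ∃ i b, a < b ∧ b ≤ a' ∧ D.Active i a ∧ 0 < D.queue i a ∧ D.rate i a < D.cap i ∧
      D.queue i b = 0

/-! ### Counting the events at one node -/

/-- An edge that receives flow moves with the label, and one that does not has slope at most `σ i`,
which the label slope dominates. Either way the gap to the label does not grow. -/
theorem Status.antitoneOn {I : Set ℝ} {w : ι → ℕ} {σ : ι → ℝ} (hs : D.Status I w σ)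
    (hI : I.OrdConnected) (hID : I ⊆ D.dom) {i : ι} (hi : w i ≠ 0)
    (hl : ∀ θ ∈ I, ∀ θ' ∈ I, θ < θ' → σ i ≤ D.labelSlope θ) :
    AntitoneOn (fun θ => D.time i θ - D.label θ) I := by
  refine antitoneOn_of_eventually_le hI (((D.time_cont i).mono hID).sub (D.label_cont.mono hID)) ?_
  intro x hx y hy hxy
  have hxd := hID hx
  filter_upwards [D.time_germ i x hxd, D.label_germ x hxd, self_mem_nhdsWithin] with z h1 h2 h3
  have h4 : D.base i + D.delaySlope i x ≤ D.labelSlope x := by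
    rcases (D.rate_nonneg i x hxd).eq_or_lt with h0 | h0
    · exact (hs.slope_le_of_rate_eq_zero hi hx h0.symm).trans (hl x hx y hy hxy)
    · exact (slope_eq_of_rate_pos hxd (hID hy) hxy h0).le
  have h5 : 0 ≤ z - x := (sub_pos.2 h3).le
  have h6 := mul_le_mul_of_nonneg_right h4 h5
  rw [h1, h2]
  unfold delaySlope at h6
  linarith

/-- When the label is this steep, active edges stay active and the queue of an active edge cannot
run empty. Each event therefore adds an active edge, so the number of active edges is strictly
increasing along `S ∩ I`, with values between `1` and the number of edges. -/
theorem HasEvents.encard_le_card {S : Set ℝ} (hS : D.HasEvents S) {I : Set ℝ}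
    (hI : I.OrdConnected) (hID : I ⊆ D.dom) {w : ι → ℕ} {σ : ι → ℝ} (hs : D.Status I w σ)
    (hl : ∀ θ ∈ I, ∀ θ' ∈ I, θ < θ' → ∀ i, w i ≠ 0 → σ i ≤ D.labelSlope θ) :
    (S ∩ I).encard ≤ Fintype.card ι := by
  classical
  have hact : ∀ i, ∀ θ ∈ I, ∀ θ' ∈ I, θ ≤ θ' → D.Active i θ → D.Active i θ' := by
    intro i θ hθ θ' hθ' hle ha
    have h1 := hs.antitoneOn hI hID (hs.weight_ne_zero hθ ha)
      (fun x hx y hy hxy => hl x hx y hy hxy i (hs.weight_ne_zero hθ ha)) hθ hθ' hle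
    have h2 := D.label_le i θ' (hID hθ')
    unfold Active at ha ⊢
    simp only [ha] at h1
    linarith
  let A : ℝ → Finset ι := fun θ => Finset.univ.filter (fun i => D.Active i θ)
  have hmono : ∀ θ ∈ I, ∀ θ' ∈ I, θ ≤ θ' → A θ ⊆ A θ' := by
    intro θ hθ θ' hθ' hle i hi
    simp only [A, Finset.mem_filter, Finset.mem_univ, true_and] at hi ⊢
    exact hact i θ hθ θ' hθ' hle hi
  have hstrict : StrictMonoOn (fun θ => (A θ).card) (S ∩ I) := by
    rintro a ⟨ha, haI⟩ a' ⟨ha', haI'⟩ hlt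
    have hsub : Icc a a' ⊆ I := hI.out haI haI'
    rcases hS a ha a' ha' (hID haI) (hID haI') hlt with
      ⟨i, c, b, hac, hcb, hba, hic, hib⟩ | ⟨i, b, hab, hba, hia, hq, hr, hqb⟩
    · have hc : c ∈ I := hsub ⟨hac.le, (hcb.le.trans hba)⟩
      have hb : b ∈ I := hsub ⟨hac.le.trans hcb.le, hba⟩
      refine Finset.card_lt_card (Finset.ssubset_of_subset_of_ssubset (hmono a haI c hc hac.le)
        (Finset.ssubset_of_ssubset_of_subset ?_ (hmono b hb a' haI' hba)))
      refine (Finset.ssubset_iff_of_subset (hmono c hc b hb hcb.le)).2 ⟨i, ?_, ?_⟩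
      · simpa [A] using hib
      · simpa [A] using hic
    -- A settled queue does not change regime. For weight `2` the draining edge would have slope
    -- below `base = σ i`, although it is active and so must keep up with a label of slope at least
    -- `σ i`.
    · exfalso
      have hw := hs.weight_ne_zero haI hia
      have h1 := labelSlope_le (hID haI) (hID haI') hlt hia
      have h2 := hl a haI a' haI' hlt i hw
      have hd : D.rate i a / D.cap i < 1 := (div_lt_one (D.cap_pos i)).2 hr
      by_cases hw1 : w i = 1
      · rcases hs.settled i hw1 with ⟨_, h3⟩ | ⟨_, h3⟩
        · exact hq.ne' (h3 a haI)
        · exact (h3 b (hsub ⟨hab.le, hba⟩)).ne' hqb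
      · rw [hs.free i hw hw1] at h2
        rw [delaySlope, if_pos hq] at h1
        linarith
  have hmaps : MapsTo (fun θ => (A θ).card) (S ∩ I)
      ((Finset.Icc 1 (Fintype.card ι) : Finset ℕ) : Set ℕ) := by
    rintro θ ⟨_, hθ⟩
    obtain ⟨i, hi⟩ := D.exists_active θ (hID hθ)
    simp only [Finset.coe_Icc, mem_Icc]
    refine ⟨Finset.card_pos.2 ⟨i, ?_⟩, Finset.card_le_univ _⟩
    exact Finset.mem_filter.2 ⟨Finset.mem_univ i, hi⟩
  have := encard_le_encard_of_injOn hmaps hstrict.injOn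
  rwa [encard_coe_eq_coe_finsetCard, Nat.card_Icc, Nat.add_sub_cancel] at this

/-- Induction on the total weight, i.e. on the number of stages the edges still have to pass. With
`d` edges, one step costs at most `d` for the steep part and then either `d` plus one recursive call
or two recursive calls, so `f (m + 1) ≤ 2 * d + 2 * f m`, which `2 * d * (2 ^ m - 1)` satisfies. -/
theorem HasEvents.encard_le_of_status {S : Set ℝ} (hS : D.HasEvents S) (m : ℕ) :
    ∀ (I : Set ℝ), I.OrdConnected → I ⊆ D.dom → (∀ θ ∈ I, ∃ θ' ∈ D.dom, θ < θ') →
      ∀ (w : ι → ℕ) (σ : ι → ℝ), D.Status I w σ → ∑ i, w i ≤ m →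
        (S ∩ I).encard ≤ ((2 * Fintype.card ι * (2 ^ m - 1) : ℕ) : ℕ∞) := by
  classical
  induction m with
  | zero =>
    intro I hI hID hlast w σ hs hw
    have hI0 : I = ∅ := by
      rw [eq_empty_iff_forall_notMem]
      intro θ hθ
      obtain ⟨i, hi⟩ := D.exists_active θ (hID hθ)
      refine hs.inactive i ?_ θ hθ hi
      have := Finset.single_le_sum (f := w) (fun i _ => Nat.zero_le _) (Finset.mem_univ i)
      omega
    simp [hI0]
  | succ m ih =>
    intro I hI hID hlast w σ hs hw
    rcases I.eq_empty_or_nonempty with rfl | ⟨θ₀, hθ₀⟩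
    · simp
    have hne : (Finset.univ.filter (fun i => w i ≠ 0)).Nonempty := by
      obtain ⟨i, hi⟩ := D.exists_active θ₀ (hID hθ₀)
      exact ⟨i, by simpa using hs.weight_ne_zero hθ₀ hi⟩
    obtain ⟨j, hj, hmax⟩ := Finset.exists_max_image _ σ hne
    have hj0 : w j ≠ 0 := by simpa using hj
    have hmax : ∀ i, w i ≠ 0 → σ i ≤ σ j := fun i hi => hmax i (by simpa using hi)
    have hup : ∀ a ∈ I, ∀ b ∈ I, a ≤ b → D.labelSlope a ≤ σ j → D.labelSlope b ≤ σ j := by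
      intro a ha b hb hab h
      obtain ⟨θ', h1, h2⟩ := hlast b hb
      exact labelSlope_le_of_le hI hID hs hmax ha hb h1 h2 hab h
    have hupd : ∀ n, n < w j → ∑ i, Function.update w j n i ≤ m := by
      intro n hn
      have : ∑ i, Function.update w j n i < ∑ i, w i := by
        refine Finset.sum_lt_sum (fun i _ => ?_) ⟨j, Finset.mem_univ j, by simpa using hn⟩
        by_cases h : i = j
        · subst h; simpa using hn.le
        · simp [h]
      omega
    set I₁ : Set ℝ := {θ ∈ I | σ j < D.labelSlope θ} with hI₁
    set I₂ : Set ℝ := {θ ∈ I | D.labelSlope θ ≤ σ j} with hI₂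
    have hsub₁ : I₁ ⊆ I := fun θ h => h.1
    have hsub₂ : I₂ ⊆ I := fun θ h => h.1
    have hc₁ : I₁.OrdConnected := by
      refine ⟨fun a ha b hb c hc => ?_⟩
      have hcI := hI.out ha.1 hb.1 hc
      refine ⟨hcI, ?_⟩
      by_contra hcon
      exact absurd (hup c hcI b hb.1 hc.2 (not_lt.1 hcon)) (not_le.2 hb.2)
    have hc₂ : I₂.OrdConnected := by
      refine ⟨fun a ha b hb c hc => ?_⟩
      have hcI := hI.out ha.1 hb.1 hc
      exact ⟨hcI, hup a ha.1 c hcI hc.1 ha.2⟩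
    have hb₁ : (S ∩ I₁).encard ≤ Fintype.card ι :=
      hS.encard_le_card hc₁ (hsub₁.trans hID) (hs.mono hsub₁)
        fun θ hθ θ' hθ' _ i hi => (hmax i hi).trans hθ.2.le
    have hunion : S ∩ I ⊆ (S ∩ I₁) ∪ (S ∩ I₂) := by
      rintro θ ⟨h1, h2⟩
      rcases lt_or_ge (σ j) (D.labelSlope θ) with h | h
      · exact Or.inl ⟨h1, h2, h⟩
      · exact Or.inr ⟨h1, h2, h⟩
    have hcard : 1 ≤ Fintype.card ι := Fintype.card_pos_iff.2 ⟨j⟩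
    have hpow : 1 ≤ 2 ^ m := Nat.one_le_two_pow
    have hb₂ : (S ∩ I₂).encard ≤
        ((Fintype.card ι + 2 * (2 * Fintype.card ι * (2 ^ m - 1)) : ℕ) : ℕ∞) := by
      -- If the queue regime of `j` is known, the slope of `j` is at least `σ j`, hence at least the
      -- label slope on `I₂`: after becoming inactive, `j` stays so. Otherwise the queue of `j` is
      -- shown to be non-increasing on `I₂`, which fixes its regime on two successive subintervals.
      by_cases hj1 : w j = 1
      · have hmon : MonotoneOn (fun θ => D.time j θ - D.label θ) I₂ := by
          have : AntitoneOn (fun θ => D.label θ - D.time j θ) I₂ := by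
            refine antitoneOn_of_eventually_le hc₂ ((D.label_cont.mono (hsub₂.trans hID)).sub
              ((D.time_cont j).mono (hsub₂.trans hID))) ?_
            intro x hx y hy hxy
            have hxd := hID hx.1
            filter_upwards [D.time_germ j x hxd, D.label_germ x hxd, self_mem_nhdsWithin]
              with z h1 h2 h3
            have h4 : D.labelSlope x ≤ D.base j + D.delaySlope j x :=
              hx.2.trans (hs.le_slope_of_settled hj1 hx.1 (D.rate_nonneg j x hxd))
            have h6 := mul_le_mul_of_nonneg_right h4 (sub_pos.2 h3).le
            rw [h1, h2]
            unfold delaySlope at h6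
            linarith
          intro x hx y hy hxy
          have := this hx hy hxy
          simp only at this ⊢
          linarith
        have hdown : ∀ a ∈ I₂, ∀ b ∈ I₂, a ≤ b → D.Active j b → D.Active j a := by
          intro a ha b hb hab h
          have h1 := hmon ha hb hab
          have h2 := D.label_le j a (hID ha.1)
          unfold Active at h ⊢
          simp only [h] at h1
          linarith
        set I₃ : Set ℝ := {θ ∈ I₂ | D.Active j θ}
        set I₄ : Set ℝ := {θ ∈ I₂ | ¬ D.Active j θ}
        have hsub₃ : I₃ ⊆ I₂ := fun θ h => h.1
        have hsub₄ : I₄ ⊆ I₂ := fun θ h => h.1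
        have hc₃ : I₃.OrdConnected := ⟨fun a ha b hb c hc =>
          ⟨hc₂.out ha.1 hb.1 hc, hdown c (hc₂.out ha.1 hb.1 hc) b hb.1 hc.2 hb.2⟩⟩
        have hc₄ : I₄.OrdConnected := ⟨fun a ha b hb c hc =>
          ⟨hc₂.out ha.1 hb.1 hc, fun h => ha.2 (hdown a ha.1 c (hc₂.out ha.1 hb.1 hc) hc.1 h)⟩⟩
        -- While `j` stays active, the label has exactly the slope of `j`, which is at least `σ j`
        -- and hence at least every relevant `σ i`; so the steep case applies again.
        have hb₃ : (S ∩ I₃).encard ≤ Fintype.card ι := by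
          refine hS.encard_le_card hc₃ ((hsub₃.trans hsub₂).trans hID)
            (hs.mono (hsub₃.trans hsub₂)) ?_
          intro θ hθ θ' hθ' hlt i hi
          refine (hmax i hi).trans ?_
          have hθd := hID hθ.1.1
          have : ∀ᶠ y in 𝓝[>] θ, D.Active j y := by
            filter_upwards [Ioo_mem_nhdsGT hlt] with y hy
            exact (hc₃.out hθ hθ' ⟨hy.1.le, hy.2.le⟩).2
          rw [← slope_eq_of_eventually_active hθd hθ.2 this.frequently]
          exact hs.le_slope_of_settled hj1 hθ.1.1 (D.rate_nonneg j θ hθd)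
        have hb₄ := ih I₄ hc₄ ((hsub₄.trans hsub₂).trans hID)
          (fun θ hθ => hlast θ hθ.1.1) (Function.update w j 0) σ
          { inactive := by
              intro i hi θ hθ
              by_cases h : i = j
              · subst h; exact hθ.2
              · exact hs.inactive i (by simpa [h] using hi) θ hθ.1.1
            settled := by
              intro i hi
              by_cases h : i = j
              · subst h; simp at hi
              · exact (hs.mono (hsub₄.trans hsub₂)).settled i (by simpa [h] using hi)
            free := by
              intro i hi hi'
              by_cases h : i = j
              · subst h; simp at hi
              · exact hs.free i (by simpa [h] using hi) (by simpa [h] using hi') }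
          (hupd 0 (Nat.pos_of_ne_zero hj0))
        have hu : S ∩ I₂ ⊆ (S ∩ I₃) ∪ (S ∩ I₄) := by
          rintro θ ⟨h1, h2⟩
          by_cases h : D.Active j θ
          · exact Or.inl ⟨h1, h2, h⟩
          · exact Or.inr ⟨h1, h2, h⟩
        refine (encard_le_encard hu).trans ((encard_union_le _ _).trans
          ((add_le_add hb₃ hb₄).trans ?_))
        norm_cast
        omega
      · have hσ : σ j = D.base j := hs.free j hj0 hj1
        -- Used or not, `j` has travel time slope at most `σ j = base j`, so its delay does not
        -- grow.
        have hanti : AntitoneOn (D.queue j) I₂ := by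
          refine antitoneOn_of_eventually_le hc₂ ((D.queue_cont j).mono (hsub₂.trans hID)) ?_
          intro x hx y hy hxy
          have hxd := hID hx.1
          have h4 : D.base j + D.delaySlope j x ≤ σ j := by
            rcases (D.rate_nonneg j x hxd).eq_or_lt with h0 | h0
            · exact hs.slope_le_of_rate_eq_zero hj0 hx.1 h0.symm
            · exact (slope_eq_of_rate_pos hxd (hID hy.1) hxy h0).le.trans hx.2
          filter_upwards [D.queue_germ j x hxd, self_mem_nhdsWithin] with z h1 h3
          have h5 : D.delaySlope j x ≤ 0 := by linarith
          have h6 := mul_nonpos_of_nonpos_of_nonneg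
            (mul_nonpos_of_nonneg_of_nonpos (D.cap_pos j).le h5) (sub_pos.2 h3).le
          rw [h1]
          unfold delaySlope at h6
          linarith
        set I₃ : Set ℝ := {θ ∈ I₂ | 0 < D.queue j θ}
        set I₄ : Set ℝ := {θ ∈ I₂ | D.queue j θ = 0}
        have hsub₃ : I₃ ⊆ I₂ := fun θ h => h.1
        have hsub₄ : I₄ ⊆ I₂ := fun θ h => h.1
        have hc₃ : I₃.OrdConnected := ⟨fun a ha b hb c hc =>
          have h := hc₂.out ha.1 hb.1 hc
          ⟨h, hb.2.trans_le (hanti h hb.1 hc.2)⟩⟩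
        have hc₄ : I₄.OrdConnected := ⟨fun a ha b hb c hc =>
          have h := hc₂.out ha.1 hb.1 hc
          ⟨h, le_antisymm ((hanti ha.1 h hc.1).trans ha.2.le) (D.queue_nonneg j c (hID h.1))⟩⟩
        have hlt : 1 < w j := by omega
        have hstat : ∀ J ⊆ I, ∀ p : ℝ, ((p = D.base j ∧ ∀ θ ∈ J, D.queue j θ = 0) ∨
            (p = D.base j - 1 ∧ ∀ θ ∈ J, 0 < D.queue j θ)) →
            D.Status J (Function.update w j 1) (Function.update σ j p) := by
          intro J hJ p hp
          refine ⟨?_, ?_, ?_⟩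
          · intro i hi θ hθ
            by_cases h : i = j
            · subst h; simp at hi
            · exact hs.inactive i (by simpa [h] using hi) θ (hJ hθ)
          · intro i hi
            by_cases h : i = j
            · subst h; simpa using hp
            · simpa [h] using (hs.mono hJ).settled i (by simpa [h] using hi)
          · intro i hi hi'
            by_cases h : i = j
            · subst h; simp at hi'
            · simpa [h] using hs.free i (by simpa [h] using hi) (by simpa [h] using hi')
        have hb₃ := ih I₃ hc₃ ((hsub₃.trans hsub₂).trans hID)
          (fun θ hθ => hlast θ hθ.1.1) _ _
          (hstat I₃ (hsub₃.trans hsub₂) (D.base j - 1) (Or.inr ⟨rfl, fun θ hθ => hθ.2⟩))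
          (hupd 1 hlt)
        have hb₄ := ih I₄ hc₄ ((hsub₄.trans hsub₂).trans hID)
          (fun θ hθ => hlast θ hθ.1.1) _ _
          (hstat I₄ (hsub₄.trans hsub₂) (D.base j) (Or.inl ⟨rfl, fun θ hθ => hθ.2⟩))
          (hupd 1 hlt)
        have hu : S ∩ I₂ ⊆ (S ∩ I₃) ∪ (S ∩ I₄) := by
          rintro θ ⟨h1, h2⟩
          rcases (D.queue_nonneg j θ (hID h2.1)).eq_or_lt with h | h
          · exact Or.inr ⟨h1, h2, h.symm⟩
          · exact Or.inl ⟨h1, h2, h⟩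
        refine (encard_le_encard hu).trans ((encard_union_le _ _).trans
          ((add_le_add hb₃ hb₄).trans ?_))
        norm_cast
        omega
    refine (encard_le_encard hunion).trans ((encard_union_le _ _).trans
      ((add_le_add hb₁ hb₂).trans ?_))
    norm_cast
    have : 2 ^ (m + 1) - 1 = 2 * (2 ^ m - 1) + 1 := by rw [pow_succ]; omega
    rw [this]
    nlinarith

/-- The number of events at a node is bounded in terms of its out-degree. -/
theorem HasEvents.encard_le {S : Set ℝ} (hS : D.HasEvents S)
    (hlast : ∀ θ ∈ D.dom, ∃ θ' ∈ D.dom, θ < θ') :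
    (S ∩ D.dom).encard ≤ ((2 * Fintype.card ι * 4 ^ Fintype.card ι : ℕ) : ℕ∞) := by
  -- Initially nothing is known: every edge has weight `2`, and `2 ^ (2 * d) = 4 ^ d`.
  refine (hS.encard_le_of_status (2 * Fintype.card ι) D.dom D.dom_ordConnected Subset.rfl hlast
    (fun _ => 2) D.base ⟨by simp, by simp, by simp⟩ (by simp [mul_comm])).trans ?_
  norm_cast
  rw [pow_mul]
  exact Nat.mul_le_mul_left _ (Nat.sub_le _ _)

end NodeDynamics

/-! ### Cumulative flows, queues and labels of a feasible flow -/

namespace FlowOverTime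

variable {E : Type*} (f : FlowOverTime E)

theorem intervalIntegrable_inRate (e : E) {a b : ℝ} (ha : 0 ≤ a) (hb : 0 ≤ b) :
    IntervalIntegrable (f.inRate e) volume a b := by
  refine ⟨(f.inRate_integrable e).mono_set fun x hx => ?_,
    (f.inRate_integrable e).mono_set fun x hx => ?_⟩
  · exact ha.trans hx.1.le
  · exact hb.trans hx.1.le

theorem intervalIntegrable_outRate (e : E) {a b : ℝ} (ha : 0 ≤ a) (hb : 0 ≤ b) :
    IntervalIntegrable (f.outRate e) volume a b := by
  refine ⟨(f.outRate_integrable e).mono_set fun x hx => ?_,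
    (f.outRate_integrable e).mono_set fun x hx => ?_⟩
  · exact ha.trans hx.1.le
  · exact hb.trans hx.1.le

theorem cumIn_sub (e : E) {a b : ℝ} (ha : 0 ≤ a) (hb : 0 ≤ b) :
    f.cumIn e b - f.cumIn e a = ∫ ζ in a..b, f.inRate e ζ :=
  intervalIntegral.integral_interval_sub_left (f.intervalIntegrable_inRate e le_rfl hb)
    (f.intervalIntegrable_inRate e le_rfl ha)

theorem cumOut_sub (e : E) {a b : ℝ} (ha : 0 ≤ a) (hb : 0 ≤ b) :
    f.cumOut e b - f.cumOut e a = ∫ ζ in a..b, f.outRate e ζ :=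
  intervalIntegral.integral_interval_sub_left (f.intervalIntegrable_outRate e le_rfl hb)
    (f.intervalIntegrable_outRate e le_rfl ha)

theorem cumIn_mono (e : E) {a b : ℝ} (ha : 0 ≤ a) (hab : a ≤ b) : f.cumIn e a ≤ f.cumIn e b := by
  have := intervalIntegral.integral_nonneg (μ := volume) hab
    fun x hx => f.inRate_nonneg e x (ha.trans hx.1)
  rw [← f.cumIn_sub e ha (ha.trans hab)] at this
  linarith

theorem cumOut_mono (e : E) {a b : ℝ} (ha : 0 ≤ a) (hab : a ≤ b) :
    f.cumOut e a ≤ f.cumOut e b := by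
  have := intervalIntegral.integral_nonneg (μ := volume) hab
    fun x hx => f.outRate_nonneg e x (ha.trans hx.1)
  rw [← f.cumOut_sub e ha (ha.trans hab)] at this
  linarith

theorem continuousOn_primitive {g : ℝ → ℝ} (hg : IntegrableOn g (Ici 0)) :
    ContinuousOn (fun θ => ∫ ζ in (0 : ℝ)..θ, g ζ) (Ici 0) := by
  have h : Continuous fun θ => ∫ ζ in (0 : ℝ)..θ, (Ici (0 : ℝ)).indicator g ζ :=
    intervalIntegral.continuous_primitive
      (fun a b => ((integrable_indicator_iff measurableSet_Ici).2 hg).intervalIntegrable) 0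
  refine h.continuousOn.congr fun θ hθ => ?_
  refine intervalIntegral.integral_congr fun x hx => ?_
  rw [uIcc_of_le hθ] at hx
  exact (indicator_of_mem (mem_Ici.2 hx.1) g).symm

theorem continuousOn_cumIn (e : E) : ContinuousOn (f.cumIn e) (Ici 0) :=
  continuousOn_primitive (f.inRate_integrable e)

theorem continuousOn_cumOut (e : E) : ContinuousOn (f.cumOut e) (Ici 0) :=
  continuousOn_primitive (f.outRate_integrable e)

end FlowOverTime

namespace SingleSinkNetwork

variable {V E : Type*} {N : SingleSinkNetwork V E} {f : FlowOverTime E}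

theorem Acyclic.src_ne_sink (hN : N.Acyclic) (e : E) : N.src e ≠ N.sink := by
  intro h
  have h1 : Relation.TransGen N.Adj N.sink (N.dst e) := Relation.TransGen.single ⟨e, h, rfl⟩
  exact hN N.sink (h1.trans_left (N.sink_reachable (N.dst e)))

theorem mem_outEdges [Fintype E] {v : V} {e : E} : e ∈ N.outEdges v ↔ N.src e = v := by
  simp [outEdges]

theorem mem_inEdges [Fintype E] {v : V} {e : E} : e ∈ N.inEdges v ↔ N.dst e = v := by
  simp [inEdges]

theorem continuousOn_queue (e : E) : ContinuousOn (N.queue f e) (Ici 0) := by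
  refine (f.continuousOn_cumIn e).sub ((f.continuousOn_cumOut e).comp
    (continuous_id.add continuous_const).continuousOn fun θ hθ => ?_)
  exact add_nonneg hθ (N.transit_pos e).le

theorem queue_sub (e : E) {a b : ℝ} (ha : 0 ≤ a) (hb : 0 ≤ b) :
    N.queue f e b - N.queue f e a =
      ∫ ζ in a..b, (f.inRate e ζ - f.outRate e (ζ + N.transit e)) := by
  have hτ := (N.transit_pos e).le
  have h1 : IntervalIntegrable (fun ζ => f.outRate e (ζ + N.transit e)) volume a b := by
    have := (f.intervalIntegrable_outRate e (add_nonneg ha hτ) (add_nonneg hb hτ)).comp_add_right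
      (N.transit e)
    simpa using this
  rw [intervalIntegral.integral_sub (f.intervalIntegrable_inRate e ha hb) h1,
    intervalIntegral.integral_comp_add_right, ← f.cumIn_sub e ha hb,
    ← f.cumOut_sub e (add_nonneg ha hτ) (add_nonneg hb hτ)]
  unfold queue
  ring

theorem intervalIntegrable_queueRate (e : E) {a b : ℝ} (ha : 0 ≤ a) (hb : 0 ≤ b) :
    IntervalIntegrable (fun ζ => f.inRate e ζ - f.outRate e (ζ + N.transit e)) volume a b := by
  have hτ := (N.transit_pos e).le
  refine (f.intervalIntegrable_inRate e ha hb).sub ?_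
  have := (f.intervalIntegrable_outRate e (add_nonneg ha hτ) (add_nonneg hb hτ)).comp_add_right
    (N.transit e)
  simpa using this

theorem queue_sub_le (e : E) {a b m : ℝ} (ha : 0 ≤ a) (hab : a ≤ b)
    (h : ∀ ζ ∈ Ioo a b, f.inRate e ζ - f.outRate e (ζ + N.transit e) ≤ m) :
    N.queue f e b - N.queue f e a ≤ m * (b - a) := by
  rw [queue_sub e ha (ha.trans hab)]
  refine (intervalIntegral.integral_mono_on_of_le_Ioo hab
    (intervalIntegrable_queueRate e ha (ha.trans hab)) intervalIntegrable_const h).trans ?_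
  simp [mul_comm]

theorem le_queue_sub (e : E) {a b m : ℝ} (ha : 0 ≤ a) (hab : a ≤ b)
    (h : ∀ ζ ∈ Ioo a b, m ≤ f.inRate e ζ - f.outRate e (ζ + N.transit e)) :
    m * (b - a) ≤ N.queue f e b - N.queue f e a := by
  rw [queue_sub e ha (ha.trans hab)]
  refine le_trans ?_ (intervalIntegral.integral_mono_on_of_le_Ioo hab intervalIntegrable_const
    (intervalIntegrable_queueRate e ha (ha.trans hab)) h)
  simp [mul_comm]

namespace IsFeasible

variable [Fintype E] (hf : N.IsFeasible f)
include hf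

theorem queue_zero (e : E) : N.queue f e 0 = 0 := by
  have h : ∫ ζ in (0 : ℝ)..(N.transit e), f.outRate e ζ = 0 := by
    rw [intervalIntegral.integral_of_le (N.transit_pos e).le, integral_Ioc_eq_integral_Ioo,
      setIntegral_congr_fun measurableSet_Ioo (g := fun _ => (0 : ℝ))]
    · simp
    · intro x hx
      exact hf.no_early_outflow e x hx.1.le hx.2
  simp [queue, FlowOverTime.cumIn, FlowOverTime.cumOut, h]

theorem outRate_le (e : E) {θ : ℝ} (hθ : 0 ≤ θ) : f.outRate e (θ + N.transit e) ≤ N.cap e := by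
  rcases lt_or_ge 0 (N.queue f e θ) with h | h
  · exact (hf.at_capacity_of_queue e θ hθ h).le
  · rw [hf.at_capacity_of_no_queue e θ hθ h]; exact min_le_right _ _

/-- After the last time with a non-negative queue, the outflow is the minimum of inflow rate and
capacity, so the queue cannot fall below its value at that time. -/
theorem queue_nonneg (e : E) {θ : ℝ} (hθ : 0 ≤ θ) : 0 ≤ N.queue f e θ := by
  by_contra hcon
  push Not at hcon
  set A : Set ℝ := {x ∈ Icc 0 θ | 0 ≤ N.queue f e x}
  have hcont : ContinuousOn (N.queue f e) (Icc 0 θ) :=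
    (continuousOn_queue e).mono Icc_subset_Ici_self
  have hA : IsClosed A := isClosed_Icc.isClosed_le continuousOn_const hcont
  have hA0 : (0 : ℝ) ∈ A := ⟨⟨le_rfl, hθ⟩, (hf.queue_zero e).ge⟩
  have hbd : BddAbove A := ⟨θ, fun x hx => hx.1.2⟩
  have hs : sSup A ∈ A := hA.csSup_mem ⟨0, hA0⟩ hbd
  have h1 := le_queue_sub (N := N) (f := f) e (m := 0) hs.1.1 hs.1.2 (by
    intro ζ hζ
    have hζ0 : 0 ≤ ζ := hs.1.1.trans hζ.1.le
    have hq : N.queue f e ζ ≤ 0 := by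
      by_contra hc
      push Not at hc
      exact absurd (le_csSup hbd (show ζ ∈ A from ⟨⟨hζ0, hζ.2.le⟩, hc.le⟩)) (not_le.2 hζ.1)
    rw [hf.at_capacity_of_no_queue e ζ hζ0 hq]
    linarith [min_le_left (f.inRate e ζ) (N.cap e)])
  linarith [hs.2]

/-- The queue length while the inflow rate into the edge is constant. -/
theorem queue_eq_projQueue (e : E) {a b : ℝ} (ha : 0 ≤ a)
    (hc : ∀ θ ∈ Ico a b, f.inRate e θ = f.inRate e a) {θ : ℝ} (hθ : θ ∈ Icc a b) :
    N.queue f e θ = N.projQueue f e a θ := by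
  have hθ0 := ha.trans hθ.1
  have hmem : ∀ ζ ∈ Ioo a θ, f.inRate e ζ = f.inRate e a := fun ζ hζ =>
    hc ζ ⟨hζ.1.le, hζ.2.trans_le hθ.2⟩
  have hlow : (f.inRate e a - N.cap e) * (θ - a) ≤ N.queue f e θ - N.queue f e a := by
    refine le_queue_sub e ha hθ.1 fun ζ hζ => ?_
    rw [hmem ζ hζ]
    linarith [hf.outRate_le e (ha.trans hζ.1.le)]
  refine le_antisymm ?_ (max_le (hf.queue_nonneg e hθ0) (by linarith))
  by_cases hcase : ∀ ζ ∈ Ioo a θ, f.outRate e (ζ + N.transit e) = N.cap e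
  · refine le_max_of_le_right ?_
    have := queue_sub_le (N := N) (f := f) e (m := f.inRate e a - N.cap e) ha hθ.1
      fun ζ hζ => by rw [hmem ζ hζ, hcase ζ hζ]
    linarith
  -- An outflow below capacity forces an empty queue and an inflow rate at most the capacity at that
  -- moment; since the inflow rate is constant, the queue cannot build up afterwards.
  · push Not at hcase
    obtain ⟨ζ, hζ, hne⟩ := hcase
    have hζ0 := ha.trans hζ.1.le
    have hq : N.queue f e ζ ≤ 0 := by
      by_contra hcon
      exact hne (hf.at_capacity_of_queue e ζ hζ0 (not_le.1 hcon))
    have hx : f.inRate e a ≤ N.cap e := by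
      by_contra hcon
      rw [hf.at_capacity_of_no_queue e ζ hζ0 hq, hmem ζ hζ, min_eq_right (not_le.1 hcon).le] at hne
      exact hne rfl
    refine le_max_of_le_left ?_
    have := queue_sub_le (N := N) (f := f) e (m := 0) hζ0 hζ.2.le (by
      intro z hz
      have hz0 := hζ0.trans hz.1.le
      have hza : f.inRate e z = f.inRate e a := hmem z ⟨hζ.1.trans hz.1, hz.2⟩
      rcases lt_or_ge 0 (N.queue f e z) with h | h
      · rw [hf.at_capacity_of_queue e z hz0 h, hza]; linarith
      · rw [hf.at_capacity_of_no_queue e z hz0 h, hza, min_eq_left hx]; linarith)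
    linarith

end IsFeasible

theorem Acyclic.wellFounded [Finite V] (hN : N.Acyclic) :
    WellFounded (fun w v : V => Relation.TransGen N.Adj v w) := by
  have : IsTrans V (fun w v : V => Relation.TransGen N.Adj v w) :=
    ⟨fun a b d h1 h2 => h2.trans h1⟩
  have : Std.Irrefl (fun w v : V => Relation.TransGen N.Adj v w) := ⟨fun a h => hN a h⟩
  exact Finite.wellFounded_of_trans_of_irrefl _

theorem continuousOn_cost (e : E) : ContinuousOn (N.cost f e) (Ici 0) :=
  continuousOn_const.add ((continuousOn_queue e).div_const _)

variable [Finite V] [Finite E]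

theorem Acyclic.isLabelling_label (hN : N.Acyclic) (θ : ℝ) :
    N.IsLabelling (fun e => N.cost f e θ) (fun v => N.label f v θ) := by
  have h : ∃ ℓ : V → ℝ, N.IsLabelling (fun e => N.cost f e θ) ℓ :=
    (N.existsUnique_labelling hN _).exists
  have h1 : (fun v => N.label f v θ) = h.choose := by
    funext v
    simp only [label, dif_pos h]
  rw [h1]
  exact h.choose_spec

theorem Acyclic.label_sink (hN : N.Acyclic) (θ : ℝ) : N.label f N.sink θ = 0 :=
  (hN.isLabelling_label θ).1

theorem Acyclic.label_le (hN : N.Acyclic) (e : E) (θ : ℝ) :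
    N.label f (N.src e) θ ≤ N.label f (N.dst e) θ + N.cost f e θ :=
  ((hN.isLabelling_label θ).2 _ (hN.src_ne_sink e)).2 ⟨e, rfl, rfl⟩

theorem Acyclic.exists_active (hN : N.Acyclic) {v : V} (hv : v ≠ N.sink) (θ : ℝ) :
    ∃ e, N.src e = v ∧ e ∈ N.activeEdges f θ := by
  obtain ⟨e, he, h⟩ := ((hN.isLabelling_label (f := f) θ).2 v hv).1
  exact ⟨e, he, by simpa [activeEdges, he] using h⟩

theorem Acyclic.continuousOn_label (hN : N.Acyclic) (v : V) :
    ContinuousOn (N.label f v) (Ici 0) := by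
  induction v using hN.wellFounded.induction with
  | _ v ih =>
    by_cases hv : v = N.sink
    · subst hv
      exact (continuousOn_const (c := (0 : ℝ))).congr fun θ _ => hN.label_sink θ
    · classical
      have := Fintype.ofFinite E
      obtain ⟨e₀, he₀, _⟩ := hN.exists_active (f := f) hv 0
      have hne : (N.outEdges v).Nonempty := ⟨e₀, mem_outEdges.2 he₀⟩
      have h : ContinuousOn (fun θ => (N.outEdges v).inf' hne
          (fun e => N.label f (N.dst e) θ + N.cost f e θ)) (Ici 0) := by
        refine ContinuousOn.finset_inf'_apply hne fun e he => ?_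
        exact (ih _ (Relation.TransGen.single ⟨e, mem_outEdges.1 he, rfl⟩)).add
          (continuousOn_cost e)
      refine h.congr fun θ _ => le_antisymm ?_ ?_
      · refine Finset.le_inf' _ _ fun e he => ?_
        have := hN.label_le (f := f) e θ
        rwa [mem_outEdges.1 he] at this
      · obtain ⟨e, he, ha⟩ := hN.exists_active (f := f) hv θ
        have h1 : N.label f (N.src e) θ = _ := ha
        rw [he] at h1
        rw [h1]
        exact Finset.inf'_le _ (mem_outEdges.2 he)

end SingleSinkNetwork

/-! ### Germs of queues under constant inflow -/

theorem max_linear_right_germ {q r a θ : ℝ} (hq : 0 ≤ q) (hθ : a ≤ θ) :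
    ∀ᶠ y in 𝓝[>] θ, max 0 (q + r * (y - a)) = max 0 (q + r * (θ - a)) +
      (if 0 < max 0 (q + r * (θ - a)) then r else max r 0) * (y - θ) := by
  by_cases h : 0 < q + r * (θ - a)
  · have hc : ContinuousAt (fun y => q + r * (y - a)) θ := by fun_prop
    have h1 : ∀ᶠ y in 𝓝 θ, 0 < q + r * (y - a) := hc.eventually_const_lt h
    filter_upwards [h1.filter_mono nhdsWithin_le_nhds] with y hy
    rw [max_eq_right hy.le, max_eq_right h.le, if_pos h]
    ring
  · rw [max_eq_left (not_lt.1 h), if_neg (lt_irrefl _)]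
    filter_upwards [self_mem_nhdsWithin] with y hy
    have hy' : 0 < y - θ := sub_pos.2 hy
    rcases le_or_gt r 0 with hr | hr
    · rw [max_eq_right hr, max_eq_left]
      · ring
      · nlinarith
    · have h2 : 0 ≤ r * (θ - a) := mul_nonneg hr.le (sub_nonneg.2 hθ)
      have h3 : q + r * (θ - a) = 0 := by linarith
      have h4 : q + r * (y - a) = r * (y - θ) := by linear_combination h3
      rw [max_eq_left hr.le, h4, max_eq_right (mul_pos hr hy').le]
      ring

/-- The truncated line has its kink where a positive, shrinking queue runs empty. The hypothesis
says that there is no such shrinking, or that the queue is still positive at `b`; then both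
one-sided slopes at `b` agree. -/
theorem max_linear_germ {q r a b : ℝ} (hq : 0 ≤ q) (hab : a < b)
    (h : 0 ≤ r ∨ q = 0 ∨ 0 < max 0 (q + r * (b - a))) :
    ∃ m, ∀ᶠ y in 𝓝 b, max 0 (q + r * (y - a)) = max 0 (q + r * (b - a)) + m * (y - b) := by
  have hy : ∀ᶠ y in 𝓝 b, a < y := lt_mem_nhds hab
  rcases le_or_gt 0 r with hr | hr
  · refine ⟨r, hy.mono fun y hy => ?_⟩
    have h1 : 0 ≤ r * (y - a) := mul_nonneg hr (sub_pos.2 hy).le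
    have h2 : 0 ≤ r * (b - a) := mul_nonneg hr (sub_pos.2 hab).le
    rw [max_eq_right (by linarith), max_eq_right (by linarith)]
    ring
  rcases h with h | h | h
  · exact absurd hr (not_lt.2 h)
  · refine ⟨0, hy.mono fun y hy => ?_⟩
    have h1 : r * (y - a) ≤ 0 := mul_nonpos_of_nonpos_of_nonneg hr.le (sub_pos.2 hy).le
    have h2 : r * (b - a) ≤ 0 := mul_nonpos_of_nonpos_of_nonneg hr.le (sub_pos.2 hab).le
    rw [max_eq_left (by linarith), max_eq_left (by linarith)]
    ring
  · have h' : 0 < q + r * (b - a) := by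
      rcases lt_max_iff.1 h with h | h
      · exact absurd h (lt_irrefl _)
      · exact h
    have hc : ContinuousAt (fun y => q + r * (y - a)) b := by fun_prop
    refine ⟨r, (hc.eventually_const_lt h').mono fun y hy => ?_⟩
    rw [max_eq_right hy.le, max_eq_right h'.le]
    ring

theorem derivWithin_Ioi_of_germ {g : ℝ → ℝ} {θ m : ℝ}
    (h : ∀ᶠ y in 𝓝[>] θ, g y = g θ + m * (y - θ)) : derivWithin g (Ioi θ) θ = m := by
  have h1 : HasDerivWithinAt (fun y => g θ + m * (y - θ)) m (Ioi θ) θ := by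
    have := ((((hasDerivAt_id θ).sub_const θ).const_mul m).const_add (g θ)).hasDerivWithinAt
      (s := Ioi θ)
    simpa using this
  exact (h1.congr_of_eventuallyEq h (by simp)).derivWithin (uniqueDiffWithinAt_Ioi θ)

/-- Makes the right derivative usable as the right-constant label slope of `NodeDynamics`. -/
theorem eventually_derivWithin_Ioi_of_germ {g : ℝ → ℝ} {θ m : ℝ}
    (h : ∀ᶠ y in 𝓝[>] θ, g y = g θ + m * (y - θ)) :
    ∀ᶠ y in 𝓝[>] θ, derivWithin g (Ioi y) y = m := by
  have h1 := eventually_eventually_nhdsWithin.2 h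
  filter_upwards [h1, h, self_mem_nhdsWithin] with y hy hy2 hy3
  refine derivWithin_Ioi_of_germ ?_
  filter_upwards [nhdsWithin_mono y (Ioi_subset_Ioi (le_of_lt hy3)) hy] with z hz
  rw [hz, hy2]; ring

/-! ### Maximal local phases and the events that end them -/

namespace SingleSinkNetwork

variable {V E : Type*} {N : SingleSinkNetwork V E} {f : FlowOverTime E}

/-- The current travel time to the sink through the edge `e`. -/
noncomputable def edgeTime (N : SingleSinkNetwork V E) (f : FlowOverTime E) (e : E) (θ : ℝ) : ℝ :=
  N.label f (N.dst e) θ + N.cost f e θ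

theorem mem_activeEdges {e : E} {θ : ℝ} :
    e ∈ N.activeEdges f θ ↔ N.edgeTime f e θ = N.label f (N.src e) θ := eq_comm

section
variable [Finite V] [Finite E]

theorem Acyclic.label_le_edgeTime (hN : N.Acyclic) (e : E) (θ : ℝ) :
    N.label f (N.src e) θ ≤ N.edgeTime f e θ := hN.label_le e θ

theorem Acyclic.continuousOn_edgeTime (hN : N.Acyclic) (e : E) :
    ContinuousOn (N.edgeTime f e) (Ici 0) :=
  (hN.continuousOn_label _).add (continuousOn_cost e)

theorem Acyclic.mem_activeEdges_iff (hN : N.Acyclic) {e : E} {θ : ℝ} :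
    e ∈ N.activeEdges f θ ↔
      ∀ e', N.src e' = N.src e → N.edgeTime f e θ ≤ N.edgeTime f e' θ := by
  rw [mem_activeEdges]
  constructor
  · intro h e' he'
    rw [h, ← he']
    exact hN.label_le_edgeTime e' θ
  · intro h
    obtain ⟨e', he', ha⟩ := hN.exists_active (f := f) (hN.src_ne_sink e) θ
    rw [mem_activeEdges] at ha
    refine le_antisymm ?_ (hN.label_le_edgeTime e θ)
    rw [← he', ← ha]
    exact h e' he'

/-- An edge that is active during an open interval is active at its end points. -/
theorem Acyclic.active_of_Ioo (hN : N.Acyclic) {e : E} {a b : ℝ} (ha : 0 ≤ a) (hab : a < b)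
    (h : ∀ θ ∈ Ioo a b, e ∈ N.activeEdges f θ) : ∀ θ ∈ Icc a b, e ∈ N.activeEdges f θ := by
  have hsub : Icc a b ⊆ Ici 0 := fun x hx => ha.trans hx.1
  have h1 : IsClosed {x ∈ Icc a b | N.edgeTime f e x = N.label f (N.src e) x} := by
    have : IsClosed ({x ∈ Icc a b | N.edgeTime f e x - N.label f (N.src e) x = 0}) :=
      (((hN.continuousOn_edgeTime e).mono hsub).sub
        ((hN.continuousOn_label (N.src e)).mono hsub)).preimage_isClosed_of_isClosed
        isClosed_Icc isClosed_singleton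
    simpa [sub_eq_zero] using this
  have h2 : Ioo a b ⊆ {x ∈ Icc a b | N.edgeTime f e x = N.label f (N.src e) x} :=
    fun x hx => ⟨⟨hx.1.le, hx.2.le⟩, mem_activeEdges.1 (h x hx)⟩
  have h3 := closure_minimal h2 h1
  rw [closure_Ioo hab.ne] at h3
  exact fun θ hθ => mem_activeEdges.2 (h3 hθ).2

end

namespace IsMaximalLocalPhase

variable [Fintype E] {v : V} {h a b : ℝ}

theorem queue_eq (H : N.IsMaximalLocalPhase f v h a b) (hf : N.IsFeasible f) (ha : 0 ≤ a) {e : E}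
    (he : N.src e = v) {θ : ℝ} (hθ : θ ∈ Icc a b) : N.queue f e θ = N.projQueue f e a θ :=
  hf.queue_eq_projQueue e ha (H.inRate_const e he) hθ

theorem projTime_eq (H : N.IsMaximalLocalPhase f v h a b) (hf : N.IsFeasible f) (ha : 0 ≤ a)
    {e : E} (he : N.src e = v) {θ : ℝ} (hθ : θ ∈ Icc a b) :
    N.projTime f e a θ = N.edgeTime f e θ := by
  rw [projTime, edgeTime, cost, H.queue_eq hf ha he hθ]

theorem queue_germ (H : N.IsMaximalLocalPhase f v h a b) (hf : N.IsFeasible f) (ha : 0 ≤ a)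
    {e : E} (he : N.src e = v) {θ : ℝ} (hθ : θ ∈ Ico a b) :
    ∀ᶠ y in 𝓝[>] θ, N.queue f e y = N.queue f e θ + N.cap e *
      (if 0 < N.queue f e θ then f.inRate e θ / N.cap e - 1
        else max (f.inRate e θ / N.cap e - 1) 0) * (y - θ) := by
  have hc := N.cap_pos e
  rw [H.inRate_const e he θ hθ, H.queue_eq hf ha he ⟨hθ.1, hθ.2.le⟩]
  filter_upwards [max_linear_right_germ (r := f.inRate e a - N.cap e) (hf.queue_nonneg e ha) hθ.1,
    Ioo_mem_nhdsGT hθ.2] with y hy hyb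
  rw [H.queue_eq hf ha he ⟨hθ.1.trans hyb.1.le, hyb.2.le⟩]
  unfold projQueue
  rw [hy]
  congr 2
  split_ifs
  · field_simp
  · rw [mul_max_of_nonneg _ _ hc.le, mul_zero, mul_sub, mul_one, mul_div_cancel₀ _ hc.ne']

theorem edgeTime_germ (H : N.IsMaximalLocalPhase f v h a b) (hf : N.IsFeasible f) (ha : 0 ≤ a)
    {e : E} (he : N.src e = v) {θ p : ℝ} (hθ : θ ∈ Ico a b)
    (hp : ∀ᶠ y in 𝓝[>] θ, N.label f (N.dst e) y = N.label f (N.dst e) θ + p * (y - θ)) :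
    ∀ᶠ y in 𝓝[>] θ, N.edgeTime f e y = N.edgeTime f e θ +
      (p + if 0 < N.queue f e θ then f.inRate e θ / N.cap e - 1
        else max (f.inRate e θ / N.cap e - 1) 0) * (y - θ) := by
  filter_upwards [H.queue_germ hf ha he hθ, hp] with y h1 h2
  have hc := (N.cap_pos e).ne'
  unfold edgeTime cost
  rw [h1, h2]
  field_simp
  ring

variable [Finite V]

theorem mem_projActive (H : N.IsMaximalLocalPhase f v h a b) (hN : N.Acyclic)
    (hf : N.IsFeasible f) (ha : 0 ≤ a) {e : E} (he : N.src e = v) {θ : ℝ} (hθ : θ ∈ Icc a b) :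
    e ∈ N.projActive f v a θ ↔ e ∈ N.activeEdges f θ := by
  rw [hN.mem_activeEdges_iff, he]
  constructor
  · rintro ⟨_, h⟩ e' he'
    have := h e' he'
    rwa [H.projTime_eq hf ha he hθ, H.projTime_eq hf ha he' hθ] at this
  · intro h
    refine ⟨he, fun e' he' => ?_⟩
    rw [H.projTime_eq hf ha he hθ, H.projTime_eq hf ha he' hθ]
    exact h e' he'

theorem active_iff (H : N.IsMaximalLocalPhase f v h a b) (hN : N.Acyclic)
    (hf : N.IsFeasible f) (ha : 0 ≤ a) {e : E} (he : N.src e = v) {θ θ' : ℝ} (hθ : θ ∈ Ioo a b)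
    (hθ' : θ' ∈ Ioo a b) : e ∈ N.activeEdges f θ ↔ e ∈ N.activeEdges f θ' := by
  rw [← H.mem_projActive hN hf ha he (Ioo_subset_Icc_self hθ),
    ← H.mem_projActive hN hf ha he (Ioo_subset_Icc_self hθ'),
    H.can_keep.active_const θ hθ θ' hθ']

theorem active_of_mem_Ioo (H : N.IsMaximalLocalPhase f v h a b) (hN : N.Acyclic)
    (hf : N.IsFeasible f) (ha : 0 ≤ a) {e : E} (he : N.src e = v) {θ : ℝ} (hθ : θ ∈ Ioo a b)
    (hθe : e ∈ N.activeEdges f θ) : ∀ θ' ∈ Icc a b, e ∈ N.activeEdges f θ' :=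
  hN.active_of_Ioo ha H.can_keep.proper fun _ hθ' => (H.active_iff hN hf ha he hθ hθ').1 hθe

/-- The active set is constant inside the phase, and activity passes to the end points by
closedness. Throughout the phase the label of `v` can thus be read off from one edge. -/
theorem exists_active (H : N.IsMaximalLocalPhase f v h a b) (hN : N.Acyclic)
    (hf : N.IsFeasible f) (hv : v ≠ N.sink) (ha : 0 ≤ a) :
    ∃ e, N.src e = v ∧ ∀ θ ∈ Icc a b, e ∈ N.activeEdges f θ := by
  obtain ⟨c, hc⟩ := nonempty_Ioo.2 H.can_keep.proper
  obtain ⟨e, he, hec⟩ := hN.exists_active (f := f) hv c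
  exact ⟨e, he, H.active_of_mem_Ioo hN hf ha he hc hec⟩

theorem exists_label_germ (H : N.IsMaximalLocalPhase f v h a b) (hN : N.Acyclic)
    (hf : N.IsFeasible f) (hv : v ≠ N.sink) (ha : 0 ≤ a) {θ : ℝ} (hθ : θ ∈ Ico a b)
    (hp : ∀ e, N.src e = v → ∃ p, ∀ᶠ y in 𝓝[>] θ,
      N.label f (N.dst e) y = N.label f (N.dst e) θ + p * (y - θ)) :
    ∃ m, ∀ᶠ y in 𝓝[>] θ, N.label f v y = N.label f v θ + m * (y - θ) := by
  obtain ⟨e, he, hact⟩ := H.exists_active hN hf hv ha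
  obtain ⟨p, hp⟩ := hp e he
  refine ⟨p + if 0 < N.queue f e θ then f.inRate e θ / N.cap e - 1
    else max (f.inRate e θ / N.cap e - 1) 0, ?_⟩
  filter_upwards [H.edgeTime_germ hf ha he hθ hp, Ioo_mem_nhdsGT hθ.2] with y h1 h2
  have e1 := mem_activeEdges.1 (hact y ⟨hθ.1.trans h2.1.le, h2.2.le⟩)
  have e2 := mem_activeEdges.1 (hact θ ⟨hθ.1, hθ.2.le⟩)
  rw [he] at e1 e2
  rw [← e1, ← e2]
  exact h1

/-- A maximal local phase ends only if an edge becomes active or the queue of an active edge runs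
empty. -/
theorem event (H : N.IsMaximalLocalPhase f v h a b) (hN : N.Acyclic) (hf : N.IsFeasible f)
    (hv : v ≠ N.sink) (ha : 0 ≤ a) {t : ℝ} (hbt : b < t) (hth : t ≤ h)
    (hgross : ∀ θ ∈ Ico a t, N.grossInflow f v θ = N.grossInflow f v a)
    (hp : ∀ e, N.src e = v → ∃ p, ∀ᶠ y in 𝓝 b,
      N.label f (N.dst e) y = N.label f (N.dst e) b + p * (y - b)) :
    (∃ e c, N.src e = v ∧ a < c ∧ c < b ∧ e ∉ N.activeEdges f c ∧ e ∈ N.activeEdges f b) ∨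
    ∃ e, N.src e = v ∧ e ∈ N.activeEdges f a ∧ 0 < N.queue f e a ∧ f.inRate e a < N.cap e ∧
      N.queue f e b = 0 := by
  by_contra hcon
  push Not at hcon
  obtain ⟨hno, hkink⟩ := hcon
  have hab : a < b := H.can_keep.proper
  have hb0 : 0 ≤ b := ha.trans hab.le
  have hbb : b ∈ Icc a b := ⟨hab.le, le_rfl⟩
  have hIoo : ∀ᶠ y in 𝓝[<] b, y ∈ Ioo a b := Ioo_mem_nhdsLT hab
  -- Assume that neither event occurs. The plan is to show that the projected active set remains the
  -- same slightly beyond `b`, contradicting maximality.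
  have hactive : ∀ e, N.src e = v → e ∈ N.activeEdges f b → ∀ θ ∈ Icc a b,
      e ∈ N.activeEdges f θ := by
    intro e he hb
    obtain ⟨c, hc⟩ := nonempty_Ioo.2 hab
    refine H.active_of_mem_Ioo hN hf ha he hc ?_
    by_contra hne
    exact hno e c he hc.1 hc.2 hne hb
  have hgerm : ∀ e, N.src e = v → e ∈ N.activeEdges f b → ∃ m, ∀ᶠ y in 𝓝 b,
      N.projTime f e a y = N.label f v b + m * (y - b) := by
    intro e he hb
    obtain ⟨p, hp⟩ := hp e he
    have hq := H.queue_eq hf ha he hbb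
    obtain ⟨m, hm⟩ := max_linear_germ (r := f.inRate e a - N.cap e) (hf.queue_nonneg e ha) hab (by
      by_cases h1 : N.cap e ≤ f.inRate e a
      · exact Or.inl (by linarith)
      rcases (hf.queue_nonneg e ha).eq_or_lt with h2 | h2
      · exact Or.inr (Or.inl h2.symm)
      · refine Or.inr (Or.inr ?_)
        have h3 := hkink e he (hactive e he hb a ⟨le_rfl, hab.le⟩) h2 (not_le.1 h1)
        rw [hq] at h3
        exact lt_of_le_of_ne (le_max_left _ _) h3.symm)
    refine ⟨p + m / N.cap e, (hp.and hm).mono ?_⟩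
    rintro y ⟨h1, h2⟩
    have h3 := H.projTime_eq hf ha he hbb
    rw [mem_activeEdges.1 hb, he] at h3
    rw [← h3]
    unfold projTime projQueue
    rw [h1, h2]
    ring
  obtain ⟨e₀, he₀, hact₀⟩ := H.exists_active hN hf hv ha
  obtain ⟨m, hm⟩ := hgerm e₀ he₀ (hact₀ b hbb)
  -- All edges active at `b` were active before `b`, so their projected times agree there. Since
  -- these have no kink at `b`, they have a common slope and keep agreeing beyond `b`.
  have hsame : ∀ e, N.src e = v → e ∈ N.activeEdges f b → ∀ᶠ y in 𝓝 b,
      N.projTime f e a y = N.label f v b + m * (y - b) := by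
    intro e he hb
    obtain ⟨m', hm'⟩ := hgerm e he hb
    obtain ⟨y, ⟨h1, h2⟩, h3⟩ := (((hm.and hm').filter_mono
      (nhdsWithin_le_nhds (s := Iio b))).and hIoo).exists
    have hy : y ∈ Icc a b := Ioo_subset_Icc_self h3
    have e1 := mem_activeEdges.1 (hactive e he hb y hy)
    have e2 := mem_activeEdges.1 (hact₀ y hy)
    rw [he, ← H.projTime_eq hf ha he hy] at e1
    rw [he₀, ← H.projTime_eq hf ha he₀ hy] at e2
    rw [e1] at h2
    rw [e2, h2] at h1
    have h4 : y - b ≠ 0 := (sub_neg.2 h3.2).ne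
    have h5 : m' = m := mul_right_cancel₀ h4 (add_left_cancel h1)
    rwa [h5] at hm'
  have hother : ∀ e, N.src e = v → e ∉ N.activeEdges f b → ∀ᶠ y in 𝓝 b,
      N.label f v b + m * (y - b) < N.projTime f e a y := by
    intro e he hb
    obtain ⟨p, hp⟩ := hp e he
    have hc : ContinuousAt (fun y => (N.label f (N.dst e) b + p * (y - b)) +
      (N.transit e + N.projQueue f e a y / N.cap e)) b := by
      unfold projQueue
      fun_prop
    have hc2 : ContinuousAt (fun y => N.label f v b + m * (y - b)) b := by fun_prop
    have hlt : N.label f v b < N.projTime f e a b := by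
      rw [H.projTime_eq hf ha he hbb, ← he]
      exact lt_of_le_of_ne (hN.label_le_edgeTime e b) fun h => hb (mem_activeEdges.2 h.symm)
    have := hc2.eventually_lt hc (by simpa [projTime] using hlt)
    filter_upwards [this, hp] with y h1 h2
    rw [projTime, h2]
    exact h1
  have hproj : ∀ᶠ y in 𝓝 b, ∀ e, e ∈ N.projActive f v a y ↔
      N.src e = v ∧ e ∈ N.activeEdges f b := by
    have hall : ∀ᶠ y in 𝓝 b, ∀ e, N.src e = v →
        (e ∈ N.activeEdges f b → N.projTime f e a y = N.label f v b + m * (y - b)) ∧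
        (e ∉ N.activeEdges f b → N.label f v b + m * (y - b) < N.projTime f e a y) := by
      rw [eventually_all]
      intro e
      by_cases he : N.src e = v
      · by_cases hb : e ∈ N.activeEdges f b
        · exact (hsame e he hb).mono fun y hy _ => ⟨fun _ => hy, fun h => absurd hb h⟩
        · exact (hother e he hb).mono fun y hy _ => ⟨fun h => absurd h hb, fun _ => hy⟩
      · exact Eventually.of_forall fun y h => absurd h he
    filter_upwards [hall] with y hy e
    constructor
    · rintro ⟨he, h1⟩
      refine ⟨he, ?_⟩
      by_contra hb
      have h2 := (hy e he).2 hb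
      have h3 := h1 e₀ he₀
      rw [(hy e₀ he₀).1 (hact₀ b hbb)] at h3
      linarith
    · rintro ⟨he, hb⟩
      refine ⟨he, fun e' he' => ?_⟩
      rw [(hy e he).1 hb]
      by_cases hb' : e' ∈ N.activeEdges f b
      · rw [(hy e' he').1 hb']
      · exact ((hy e' he').2 hb').le
  obtain ⟨b', hb', hball⟩ : ∃ b' ∈ Ioc b t, ∀ y ∈ Ico b b', ∀ e, e ∈ N.projActive f v a y ↔
      N.src e = v ∧ e ∈ N.activeEdges f b := by
    obtain ⟨u, hu, hsub⟩ := exists_Ico_subset_of_mem_nhds hproj ⟨t, hbt⟩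
    refine ⟨min u t, ⟨lt_min hu hbt, min_le_right _ _⟩, fun y hy => ?_⟩
    exact hsub ⟨hy.1, hy.2.trans_le (min_le_left _ _)⟩
  have hIooact : ∀ y ∈ Ioo a b, ∀ e, e ∈ N.projActive f v a y ↔
      N.src e = v ∧ e ∈ N.activeEdges f b := by
    intro y hy e
    by_cases he : N.src e = v
    · rw [H.mem_projActive hN hf ha he (Ioo_subset_Icc_self hy)]
      exact ⟨fun h => ⟨he, H.active_of_mem_Ioo hN hf ha he hy h b hbb⟩,
        fun h => hactive e he h.2 y (Ioo_subset_Icc_self hy)⟩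
    · exact ⟨fun h => absurd h.1 he, fun h => absurd h.1 he⟩
  have hcomb : ∀ y ∈ Ioo a b', ∀ e, e ∈ N.projActive f v a y ↔
      N.src e = v ∧ e ∈ N.activeEdges f b := by
    intro y hy
    rcases lt_or_ge y b with h1 | h1
    · exact hIooact y ⟨hy.1, h1⟩
    · exact hball y ⟨h1, hy.2⟩
  -- The old distribution could be kept until `b'`, later than `b`.
  refine H.maximal b' hb'.1 (hb'.2.trans hth) ⟨hab.trans hb'.1, ?_, ?_, ?_⟩
  · exact fun θ hθ => hgross θ ⟨hθ.1, hθ.2.trans_le hb'.2⟩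
  · intro e he hpos θ hθ
    rcases lt_or_ge θ b with h1 | h1
    · exact H.can_keep.used_active e he hpos θ ⟨hθ.1, h1⟩
    · obtain ⟨c, hc⟩ := nonempty_Ioo.2 hab
      rw [hball θ ⟨h1, hθ.2⟩, ← hIooact c hc]
      exact H.can_keep.used_active e he hpos c ⟨hc.1.le, hc.2⟩
  · intro θ hθ θ' hθ'
    ext e
    rw [hcomb θ hθ, hcomb θ' hθ']

end IsMaximalLocalPhase

end SingleSinkNetwork

/-! ### Break points and piecewise regularity -/

theorem encard_inter_Ico_le {S : Set ℝ} {lo : ℝ} {B : ℕ} (X : Finset ℝ) :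
    ∀ hi : ℝ, (∀ s t, lo ≤ s → s < t → t ≤ hi → (∀ x ∈ X, x ∉ Ioo s t) →
      (S ∩ Ico s t).encard ≤ B) →
    (S ∩ Ico lo hi).encard ≤ (((X.card + 1) * B : ℕ) : ℕ∞) := by
  induction X using Finset.induction_on_max with
  | empty =>
    intro hi h
    rcases lt_or_ge lo hi with h1 | h1
    · simpa using h lo hi le_rfl h1 le_rfl (by simp)
    · simp [Ico_eq_empty (not_lt.2 h1)]
  | insert x X hx ih =>
    intro hi h
    have hxX : x ∉ X := fun hmem => lt_irrefl x (hx x hmem)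
    rw [Finset.card_insert_of_notMem hxX]
    by_cases hmem : x ∈ Ioo lo hi
    · have h1 := ih x fun s t hs hst ht hd => h s t hs hst (ht.trans hmem.2.le) (by
        intro y hy
        rcases Finset.mem_insert.1 hy with rfl | hy
        · exact fun hy => absurd (hy.2.trans_le ht) (lt_irrefl _)
        · exact hd y hy)
      have h2 := h x hi hmem.1.le hmem.2 le_rfl (by
        intro y hy
        rcases Finset.mem_insert.1 hy with rfl | hy
        · exact fun hy => lt_irrefl _ hy.1
        · exact fun hy' => lt_asymm hy'.1 (hx y hy))
      have hu : S ∩ Ico lo hi ⊆ (S ∩ Ico lo x) ∪ (S ∩ Ico x hi) := by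
        rintro y ⟨hy, hy1, hy2⟩
        rcases lt_or_ge y x with h3 | h3
        · exact Or.inl ⟨hy, hy1, h3⟩
        · exact Or.inr ⟨hy, h3, hy2⟩
      refine (encard_le_encard hu).trans ((encard_union_le _ _).trans
        ((add_le_add h1 h2).trans ?_))
      norm_cast
      exact le_of_eq (by ring)
    · have h1 := ih hi fun s t hs hst ht hd => h s t hs hst ht (by
        intro y hy
        rcases Finset.mem_insert.1 hy with rfl | hy
        · exact fun hy => hmem ⟨hs.trans_lt hy.1, hy.2.trans_le ht⟩
        · exact hd y hy)
      refine h1.trans ?_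
      norm_cast
      exact Nat.mul_le_mul_right _ (by omega)

theorem max_linear_of_neg {q r a s t : ℝ} (hr : r < 0) (h : a + q / (-r) ∉ Ioo s t) :
    (∀ y ∈ Icc s t, max 0 (q + r * (y - a)) = 0) ∨
      ((∀ y ∈ Icc s t, max 0 (q + r * (y - a)) = q + r * (y - a)) ∧
        ∀ y ∈ Ico s t, 0 < max 0 (q + r * (y - a))) := by
  set z := a + q / (-r) with hz
  have hlin : ∀ y, q + r * (y - a) = r * (y - z) := by
    intro y
    have h0 : r * (q / (-r)) = -q := by rw [div_neg, mul_neg, mul_div_cancel₀ _ hr.ne]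
    rw [hz]
    linear_combination h0
  rcases le_or_gt z s with h1 | h1
  · refine Or.inl fun y hy => max_eq_left ?_
    rw [hlin]
    exact mul_nonpos_of_nonpos_of_nonneg hr.le (by linarith [hy.1])
  · have h2 : t ≤ z := by
      by_contra hcon
      exact h ⟨h1, not_le.1 hcon⟩
    refine Or.inr ⟨fun y hy => max_eq_right ?_, fun y hy => lt_max_of_lt_right ?_⟩
    · rw [hlin]
      exact mul_nonneg_of_nonpos_of_nonpos hr.le (by linarith [hy.2])
    · rw [hlin]
      exact mul_pos_of_neg_of_neg hr (by linarith [hy.2])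

theorem max_linear_affine {q r a s t : ℝ} (hq : 0 ≤ q) (has : a ≤ s) (hst : s ≤ t)
    (h : a + q / (-r) ∉ Ioo s t) :
    ∃ m, ∀ y ∈ Icc s t, max 0 (q + r * (y - a)) = max 0 (q + r * (s - a)) + m * (y - s) := by
  have hs : s ∈ Icc s t := ⟨le_rfl, hst⟩
  -- For `r ≥ 0` the truncation has no effect and the excluded point plays no role; for `r = 0`
  -- division by zero makes it `a`.
  rcases le_or_gt 0 r with hr | hr
  · refine ⟨r, fun y hy => ?_⟩
    have h1 : 0 ≤ r * (y - a) := mul_nonneg hr (sub_nonneg.2 (has.trans hy.1))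
    have h2 : 0 ≤ r * (s - a) := mul_nonneg hr (sub_nonneg.2 has)
    rw [max_eq_right (by linarith), max_eq_right (by linarith)]
    ring
  · rcases max_linear_of_neg hr h with h1 | ⟨h1, _⟩
    · exact ⟨0, fun y hy => by rw [h1 y hy, h1 s hs]; ring⟩
    · exact ⟨r, fun y hy => by rw [h1 y hy, h1 s hs]; ring⟩

/-- On `[0, T)`, the function `g` is a right-constant step function with jumps in `X`. -/
def StepOn {α : Type*} (X : Finset ℝ) (T : ℝ) (g : ℝ → α) : Prop :=
  ∀ s t, 0 ≤ s → s < t → t ≤ T → (∀ x ∈ X, x ∉ Ioo s t) → ∀ θ ∈ Ico s t, g θ = g s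

/-- On `[0, T]`, the function `g` is piecewise affine with break points in `X`. -/
def PiecewiseAffineOn (X : Finset ℝ) (T : ℝ) (g : ℝ → ℝ) : Prop :=
  ∀ s t, 0 ≤ s → s < t → t ≤ T → (∀ x ∈ X, x ∉ Ioo s t) →
    ∃ p, ∀ θ ∈ Icc s t, g θ = g s + p * (θ - s)

theorem StepOn.mono {α : Type*} {X Y : Finset ℝ} {T : ℝ} {g : ℝ → α} (h : StepOn X T g)
    (hXY : X ⊆ Y) : StepOn Y T g :=
  fun s t hs hst ht hd => h s t hs hst ht fun x hx => hd x (hXY hx)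

theorem PiecewiseAffineOn.mono {X Y : Finset ℝ} {T : ℝ} {g : ℝ → ℝ} (h : PiecewiseAffineOn X T g)
    (hXY : X ⊆ Y) : PiecewiseAffineOn Y T g :=
  fun s t hs hst ht hd => h s t hs hst ht fun x hx => hd x (hXY hx)

namespace SingleSinkNetwork

variable {V E : Type*} {N : SingleSinkNetwork V E} {f : FlowOverTime E}

/-- The number of local phases at a node while its gross inflow rate is constant and the labels
of the heads of its outgoing edges are affine. -/
theorem encard_starts_le [Finite V] [Fintype E] (hN : N.Acyclic) (hf : N.IsIDE f) {v : V}
    (hv : v ≠ N.sink)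
    {s t h : ℝ} (hs : 0 ≤ s) (hth : t ≤ h) {Φ : Set (ℝ × ℝ)}
    (hpos : ∀ I ∈ Φ, 0 ≤ I.1) (hmax : ∀ I ∈ Φ, N.IsMaximalLocalPhase f v h I.1 I.2)
    (hcover : ∀ θ ∈ Ico s t, ∃ I ∈ Φ, θ ∈ Ico I.1 I.2)
    (hdisj : ∀ I ∈ Φ, ∀ J ∈ Φ, I.1 < J.1 → I.2 ≤ J.1)
    (hgross : ∀ θ ∈ Ico s t, N.grossInflow f v θ = N.grossInflow f v s)
    (hlab : ∀ e, N.src e = v → ∃ p, ∀ θ ∈ Icc s t,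
      N.label f (N.dst e) θ = N.label f (N.dst e) s + p * (θ - s)) :
    (Prod.fst '' Φ ∩ Ico s t).encard ≤
      ((2 * (N.outEdges v).card * 4 ^ (N.outEdges v).card : ℕ) : ℕ∞) := by
  have hlab' : ∀ e : N.outEdges v, ∃ p, ∀ θ ∈ Icc s t,
      N.label f (N.dst e) θ = N.label f (N.dst e) s + p * (θ - s) :=
    fun e => hlab e (mem_outEdges.1 e.2)
  choose p hp using hlab'
  have hsrc : ∀ e : N.outEdges v, N.src e = v := fun e => mem_outEdges.1 e.2
  have hpos0 : ∀ θ ∈ Ico s t, 0 ≤ θ := fun θ hθ => hs.trans hθ.1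
  have hsub0 : Ico s t ⊆ Ici 0 := hpos0
  have hpgerm : ∀ e : N.outEdges v, ∀ θ ∈ Ico s t, ∀ᶠ y in 𝓝[>] θ,
      N.label f (N.dst e) y = N.label f (N.dst e) θ + p e * (y - θ) := by
    intro e θ hθ
    filter_upwards [Ioo_mem_nhdsGT hθ.2] with y hy
    rw [hp e y ⟨hθ.1.trans hy.1.le, hy.2.le⟩, hp e θ ⟨hθ.1, hθ.2.le⟩]
    ring
  have hlgerm : ∀ θ ∈ Ico s t, ∃ m, ∀ᶠ y in 𝓝[>] θ,
      N.label f v y = N.label f v θ + m * (y - θ) := by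
    intro θ hθ
    obtain ⟨I, hI, hθI⟩ := hcover θ hθ
    exact (hmax I hI).exists_label_germ hN hf.1 hv (hpos I hI) hθI
      fun e he => ⟨_, hpgerm ⟨e, mem_outEdges.2 he⟩ θ hθ⟩
  let D : NodeDynamics (N.outEdges v) :=
    { dom := Ico s t
      dom_ordConnected := ordConnected_Ico
      cap := fun e => N.cap e
      cap_pos := fun e => N.cap_pos e
      base := p
      gross := N.grossInflow f v s
      rate := fun e => f.inRate e
      queue := fun e => N.queue f e
      time := fun e => N.edgeTime f e
      label := N.label f v
      labelSlope := fun θ => derivWithin (N.label f v) (Ioi θ) θ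
      rate_nonneg := fun e θ hθ => f.inRate_nonneg e θ (hpos0 θ hθ)
      sum_rate := by
        intro θ hθ
        rw [← hgross θ hθ, Finset.sum_coe_sort (N.outEdges v) fun e => f.inRate e θ]
        have := hf.1.conservation v hv θ (hpos0 θ hθ)
        unfold grossInflow
        linarith
      queue_nonneg := fun e θ hθ => hf.1.queue_nonneg e (hpos0 θ hθ)
      label_le := fun e θ hθ => by
        have := hN.label_le_edgeTime (f := f) (e : E) θ
        rwa [hsrc] at this
      exists_active := fun θ hθ => by
        obtain ⟨e, he, hact⟩ := hN.exists_active (f := f) hv θ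
        have := mem_activeEdges.1 hact
        rw [he] at this
        exact ⟨⟨e, mem_outEdges.2 he⟩, this⟩
      active_of_rate_pos := fun e θ hθ hr => by
        have := mem_activeEdges.1 (hf.2 θ (hpos0 θ hθ) e hr)
        rwa [hsrc] at this
      queue_cont := fun e => (continuousOn_queue (e : E)).mono hsub0
      time_cont := fun e => (hN.continuousOn_edgeTime (e : E)).mono hsub0
      label_cont := (hN.continuousOn_label v).mono hsub0
      rate_germ := fun e θ hθ => by
        obtain ⟨I, hI, hθI⟩ := hcover θ hθ
        filter_upwards [Ioo_mem_nhdsGT hθI.2] with y hy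
        rw [(hmax I hI).inRate_const e (hsrc e) θ hθI,
          (hmax I hI).inRate_const e (hsrc e) y ⟨hθI.1.trans hy.1.le, hy.2⟩]
      labelSlope_germ := fun θ hθ => by
        obtain ⟨m, hm⟩ := hlgerm θ hθ
        filter_upwards [eventually_derivWithin_Ioi_of_germ hm] with y hy
        rw [hy, derivWithin_Ioi_of_germ hm]
      label_germ := fun θ hθ => by
        obtain ⟨m, hm⟩ := hlgerm θ hθ
        rwa [derivWithin_Ioi_of_germ hm]
      queue_germ := fun e θ hθ => by
        obtain ⟨I, hI, hθI⟩ := hcover θ hθ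
        exact (hmax I hI).queue_germ hf.1 (hpos I hI) (hsrc e) hθI
      time_germ := fun e θ hθ => by
        obtain ⟨I, hI, hθI⟩ := hcover θ hθ
        exact (hmax I hI).edgeTime_germ hf.1 (hpos I hI) (hsrc e) hθI (hpgerm e θ hθ) }
  have hact : ∀ (e : E) (he : N.src e = v) (θ : ℝ),
      D.Active ⟨e, mem_outEdges.2 he⟩ θ ↔ e ∈ N.activeEdges f θ := by
    intro e he θ
    have h1 : N.label f (N.src e) θ = N.label f v θ := by rw [he]
    rw [mem_activeEdges, h1]
    exact Iff.rfl
  have hS : D.HasEvents (Prod.fst '' Φ) := by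
    rintro _ ⟨I, hI, rfl⟩ _ ⟨J, hJ, rfl⟩ ha ha' hlt
    have hIJ := hdisj I hI J hJ hlt
    have hH := hmax I hI
    have hab := hH.can_keep.proper
    -- A later phase starts before `t`, so `I` ends strictly inside the regular interval and the
    -- event lemma applies.
    have hbt : I.2 < t := hIJ.trans_lt ha'.2
    rcases hH.event hN hf.1 hv (hpos I hI) hbt hth
      (fun θ hθ => (hgross θ ⟨ha.1.trans hθ.1, hθ.2⟩).trans (hgross I.1 ha).symm)
      (fun e he => ⟨p ⟨e, mem_outEdges.2 he⟩, by
        filter_upwards [Ioo_mem_nhds hab hbt] with y hy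
        have e1 := hp ⟨e, mem_outEdges.2 he⟩ y ⟨ha.1.trans hy.1.le, hy.2.le⟩
        have e2 := hp ⟨e, mem_outEdges.2 he⟩ I.2 ⟨ha.1.trans hab.le, hbt.le⟩
        simp only at e1 e2
        rw [e1, e2]
        ring⟩) with ⟨e, c, he, h1, h2, h3, h4⟩ | ⟨e, he, h1, h2, h3, h4⟩
    · exact Or.inl ⟨⟨e, mem_outEdges.2 he⟩, c, I.2, h1, h2, hIJ,
        fun h => h3 ((hact e he c).1 h), (hact e he _).2 h4⟩
    · exact Or.inr ⟨⟨e, mem_outEdges.2 he⟩, I.2, hab, hIJ, (hact e he _).2 h1, h2, h3, h4⟩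
  have := hS.encard_le fun θ (hθ : θ ∈ Ico s t) => by
    obtain ⟨θ', h1⟩ := nonempty_Ioo.2 hθ.2
    exact ⟨θ', ⟨hθ.1.trans h1.1.le, h1.2⟩, h1.1⟩
  rwa [Fintype.card_coe] at this

/-- Up to the times `H v`, everything that happens at the nodes `v` is regular away from `X`. -/
structure RegularUpTo (N : SingleSinkNetwork V E) (f : FlowOverTime E) (X : Finset ℝ)
    (H : V → ℝ) : Prop where
  inRate : ∀ e, StepOn X (H (N.src e)) (f.inRate e)
  outRate : ∀ e, StepOn X (H (N.src e) + N.transit e) (f.outRate e)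
  label : ∀ v, PiecewiseAffineOn X (H v) (N.label f v)
  active : ∀ e s t, 0 ≤ s → t ≤ H (N.src e) → (∀ x ∈ X, x ∉ Ioo s t) →
    ∀ θ ∈ Ioo s t, ∀ θ' ∈ Ioo s t, e ∈ N.activeEdges f θ ↔ e ∈ N.activeEdges f θ'
  inflow : ∀ v T, StepOn X T (N.inflow v)

namespace RegularUpTo

variable {X : Finset ℝ} {H : V → ℝ}

/-- Edge outflow is determined one travel time beyond edge inflow, so gross inflow is regular up to
times that the tails of the incoming edges need not have reached yet. -/
theorem grossInflow [Fintype E] (hr : N.RegularUpTo f X H) {v : V} {T : ℝ}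
    (hT : ∀ e, N.dst e = v → T ≤ H (N.src e) + N.transit e) :
    StepOn X T (N.grossInflow f v) := by
  intro s t hs hst ht hd θ hθ
  unfold SingleSinkNetwork.grossInflow
  rw [hr.inflow v T s t hs hst ht hd θ hθ]
  congr 1
  exact Finset.sum_congr rfl fun e he =>
    hr.outRate e s t hs hst (ht.trans (hT e (mem_inEdges.1 he))) hd θ hθ

theorem update_sink [Finite V] [Finite E] [DecidableEq V] (hr : N.RegularUpTo f X H)
    (hN : N.Acyclic) (T : ℝ) : N.RegularUpTo f X (Function.update H N.sink T) where
  inRate e := by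
    rw [Function.update_of_ne (hN.src_ne_sink e)]; exact hr.inRate e
  outRate e := by
    rw [Function.update_of_ne (hN.src_ne_sink e)]; exact hr.outRate e
  label v := by
    by_cases h : v = N.sink
    · subst h
      exact fun s t _ _ _ _ => ⟨0, fun θ _ => by simp [hN.label_sink]⟩
    · rw [Function.update_of_ne h]; exact hr.label v
  active e := by
    rw [Function.update_of_ne (hN.src_ne_sink e)]; exact hr.active e
  inflow := hr.inflow

end RegularUpTo

/-- A covering of `[lo, hi)` by maximal local phases at `v`. -/
structure IsPhaseCover [Fintype E] (N : SingleSinkNetwork V E) (f : FlowOverTime E) (v : V)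
    (lo hi : ℝ) (Φ : Set (ℝ × ℝ)) : Prop where
  le_start : ∀ I ∈ Φ, lo ≤ I.1
  maximal : ∀ I ∈ Φ, N.IsMaximalLocalPhase f v hi I.1 I.2
  cover : ∀ θ ∈ Ico lo hi, ∃! I : ℝ × ℝ, I ∈ Φ ∧ θ ∈ Ico I.1 I.2

namespace IsPhaseCover

variable [Fintype E] {v : V} {lo hi : ℝ} {Φ : Set (ℝ × ℝ)} (hΦ : N.IsPhaseCover f v lo hi Φ)
include hΦ

theorem start_mem {I : ℝ × ℝ} (hI : I ∈ Φ) : I.1 ∈ Ico lo hi :=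
  ⟨hΦ.le_start I hI, (hΦ.maximal I hI).can_keep.proper.trans_le (hΦ.maximal I hI).le_end⟩

theorem eq_of_mem {I J : ℝ × ℝ} (hI : I ∈ Φ) (hJ : J ∈ Φ) {θ : ℝ} (h1 : θ ∈ Ico I.1 I.2)
    (h2 : θ ∈ Ico J.1 J.2) : I = J :=
  (hΦ.cover θ ⟨(hΦ.le_start I hI).trans h1.1, h1.2.trans_le (hΦ.maximal I hI).le_end⟩).unique
    ⟨hI, h1⟩ ⟨hJ, h2⟩

theorem end_le {I J : ℝ × ℝ} (hI : I ∈ Φ) (hJ : J ∈ Φ) (h : I.1 < J.1) : I.2 ≤ J.1 := by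
  by_contra hcon
  have := hΦ.eq_of_mem hI hJ ⟨h.le, not_le.1 hcon⟩ ⟨le_rfl, (hΦ.maximal J hJ).can_keep.proper⟩
  rw [this] at h
  exact lt_irrefl _ h

theorem injOn_fst : InjOn Prod.fst Φ := by
  intro I hI J hJ h
  exact hΦ.eq_of_mem hI hJ ⟨le_rfl, (hΦ.maximal I hI).can_keep.proper⟩
    ⟨h.ge, h ▸ (hΦ.maximal J hJ).can_keep.proper⟩

theorem lo_mem (h : lo < hi) : lo ∈ Prod.fst '' Φ := by
  obtain ⟨I, ⟨hI, hθ⟩, _⟩ := hΦ.cover lo ⟨le_rfl, h⟩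
  exact ⟨I, hI, le_antisymm hθ.1 (hΦ.le_start I hI)⟩

/-- If the phase covering `s` ended before `t`, the phase covering its end point would start inside
`(s, t)`. -/
theorem exists_phase {s t : ℝ} (hs : lo ≤ s) (hst : s < t) (ht : t ≤ hi)
    (hd : ∀ x ∈ Prod.fst '' Φ, x ∉ Ioo s t) : ∃ I ∈ Φ, I.1 ≤ s ∧ t ≤ I.2 := by
  obtain ⟨I, ⟨hI, hθ⟩, _⟩ := hΦ.cover s ⟨hs, hst.trans_le ht⟩
  refine ⟨I, hI, hθ.1, ?_⟩
  by_contra hcon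
  push Not at hcon
  obtain ⟨J, ⟨hJ, hθJ⟩, _⟩ := hΦ.cover I.2 ⟨hs.trans hθ.2.le, hcon.trans_le ht⟩
  rcases lt_trichotomy I.1 J.1 with h | h | h
  · have := hΦ.end_le hI hJ h
    exact hd J.1 ⟨J, hJ, rfl⟩ ⟨hθ.2.trans_le this, hθJ.1.trans_lt hcon⟩
  · have := hΦ.injOn_fst hI hJ h
    rw [this] at hθJ
    exact lt_irrefl _ hθJ.2
  · have := hΦ.end_le hJ hI h
    have h2 := (hΦ.maximal I hI).can_keep.proper
    linarith [hθJ.2]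

variable {X : Finset ℝ} {H : V → ℝ}

theorem encard_le [Finite V] (hN : N.Acyclic) (hf : N.IsIDE f) (hv : v ≠ N.sink) (hlo : 0 ≤ lo)
    (hr : N.RegularUpTo f X H) (hsucc : ∀ e, N.src e = v → hi ≤ H (N.dst e))
    (hpred : ∀ e, N.dst e = v → hi ≤ H (N.src e) + N.transit e) :
    Φ.encard ≤ (((X.card + 1) * (2 * (N.outEdges v).card * 4 ^ (N.outEdges v).card) : ℕ) : ℕ∞) := by
  have h1 : (Prod.fst '' Φ ∩ Ico lo hi).encard ≤
      (((X.card + 1) * (2 * (N.outEdges v).card * 4 ^ (N.outEdges v).card) : ℕ) : ℕ∞) := by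
    refine encard_inter_Ico_le X hi fun s t hs hst ht hd => ?_
    have hs0 := hlo.trans hs
    refine encard_starts_le hN hf hv hs0 ht (fun I hI => hlo.trans (hΦ.le_start I hI))
      hΦ.maximal ?_ (fun I hI J hJ => hΦ.end_le hI hJ)
      (hr.grossInflow hpred s t hs0 hst ht hd) ?_
    · intro θ hθ
      obtain ⟨I, hI, _⟩ := hΦ.cover θ ⟨hs.trans hθ.1, hθ.2.trans_le ht⟩
      exact ⟨I, hI⟩
    · exact fun e he => hr.label _ s t hs0 hst (ht.trans (hsucc e he)) hd
  rwa [inter_eq_left.2, hΦ.injOn_fst.encard_image] at h1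
  rintro _ ⟨I, hI, rfl⟩
  exact hΦ.start_mem hI

end IsPhaseCover

/-- The time at which the queue on `e` would run empty if the inflow rate at time `a` were kept. -/
noncomputable def depletionTime (N : SingleSinkNetwork V E) (f : FlowOverTime E) (e : E)
    (a : ℝ) : ℝ :=
  a + N.queue f e a / (-(f.inRate e a - N.cap e))

namespace IsMaximalLocalPhase

variable [Fintype E] {v : V} {h a b : ℝ}

theorem queue_affine (H : N.IsMaximalLocalPhase f v h a b) (hf : N.IsFeasible f) (ha : 0 ≤ a)
    {e : E} (he : N.src e = v) {s t : ℝ} (has : a ≤ s) (hst : s < t) (htb : t ≤ b)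
    (hd : N.depletionTime f e a ∉ Ioo s t) :
    ∃ m, ∀ θ ∈ Icc s t, N.queue f e θ = N.queue f e s + m * (θ - s) := by
  obtain ⟨m, hm⟩ := max_linear_affine (hf.queue_nonneg e ha) has hst.le hd
  refine ⟨m, fun θ hθ => ?_⟩
  rw [H.queue_eq hf ha he ⟨has.trans hθ.1, hθ.2.trans htb⟩,
    H.queue_eq hf ha he ⟨has, hst.le.trans htb⟩]
  exact hm θ hθ

/-- Outflow after one travel time depends only on the inflow rate, which is constant, and on whether
the queue is positive, which for inflow below capacity changes only at the depletion time. For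
inflow at least the capacity, the outflow is the capacity in either case. -/
theorem outRate_const (H : N.IsMaximalLocalPhase f v h a b) (hf : N.IsFeasible f) (ha : 0 ≤ a)
    {e : E} (he : N.src e = v) {s t : ℝ} (has : a ≤ s) (hst : s < t) (htb : t ≤ b)
    (hd : N.depletionTime f e a ∉ Ioo s t) :
    ∀ θ ∈ Ico s t, f.outRate e (θ + N.transit e) = f.outRate e (s + N.transit e) := by
  suffices ∃ c, ∀ θ ∈ Ico s t, f.outRate e (θ + N.transit e) = c by
    obtain ⟨c, hc⟩ := this
    exact fun θ hθ => (hc θ hθ).trans (hc s ⟨le_rfl, hst⟩).symm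
  have h0 : ∀ θ ∈ Ico s t, 0 ≤ θ := fun θ hθ => ha.trans (has.trans hθ.1)
  have hx : ∀ θ ∈ Ico s t, f.inRate e θ = f.inRate e a := fun θ hθ =>
    H.inRate_const e he θ ⟨has.trans hθ.1, hθ.2.trans_le htb⟩
  have hq : ∀ θ ∈ Ico s t, N.queue f e θ =
      max 0 (N.queue f e a + (f.inRate e a - N.cap e) * (θ - a)) := fun θ hθ =>
    H.queue_eq hf ha he ⟨has.trans hθ.1, hθ.2.le.trans htb⟩
  rcases lt_or_ge (f.inRate e a - N.cap e) 0 with hr | hr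
  · rcases max_linear_of_neg hr hd with h1 | ⟨_, h1⟩
    · refine ⟨min (f.inRate e a) (N.cap e), fun θ hθ => ?_⟩
      rw [hf.at_capacity_of_no_queue e θ (h0 θ hθ), hx θ hθ]
      rw [hq θ hθ]
      exact (h1 θ ⟨hθ.1, hθ.2.le⟩).le
    · refine ⟨N.cap e, fun θ hθ => hf.at_capacity_of_queue e θ (h0 θ hθ) ?_⟩
      rw [hq θ hθ]
      exact h1 θ hθ
  · refine ⟨N.cap e, fun θ hθ => ?_⟩
    rcases lt_or_ge 0 (N.queue f e θ) with h1 | h1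
    · exact hf.at_capacity_of_queue e θ (h0 θ hθ) h1
    · rw [hf.at_capacity_of_no_queue e θ (h0 θ hθ) h1, hx θ hθ, min_eq_right (by linarith)]

end IsMaximalLocalPhase

namespace RegularUpTo

variable [Finite V] [Fintype E] [DecidableEq V]
variable {v : V} {lo hi : ℝ} {Φ : Set (ℝ × ℝ)} {X : Finset ℝ} {H : V → ℝ}

/-- The regularity of a flow is extended by processing one more node. -/
theorem step (hr : N.RegularUpTo f X H) (hN : N.Acyclic) (hf : N.IsIDE f)
    (hΦ : N.IsPhaseCover f v lo hi Φ) (hv : v ≠ N.sink) (hlo : 0 ≤ lo) (hlohi : lo < hi)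
    (hH : H v = lo) (hsucc : ∀ e, N.src e = v → hi ≤ H (N.dst e))
    {S : Finset ℝ} (hS : (S : Set ℝ) = Prod.fst '' Φ) :
    ∃ X' : Finset ℝ, X'.card ≤ X.card + S.card * (1 + 3 * (N.outEdges v).card) ∧
      N.RegularUpTo f X' (Function.update H v hi) := by
  classical
  -- Each phase start contributes, for every edge, the kink of the queue and the two times, delayed
  -- by the travel time, at which the outflow rate can change: hence the count `1 + 3 * d` per
  -- phase, including the start itself.
  set G : E → Finset ℝ := fun e => S.image (N.depletionTime f e) ∪
    (S.image (fun a => a + N.transit e) ∪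
      S.image (fun a => N.depletionTime f e a + N.transit e)) with hG
  set X' : Finset ℝ := X ∪ (S ∪ (N.outEdges v).biUnion G) with hX'
  have hX : X ⊆ X' := Finset.subset_union_left
  have hSX : S ⊆ X' := Finset.subset_union_left.trans Finset.subset_union_right
  have hGX : ∀ e, N.src e = v → G e ⊆ X' := fun e he =>
    (Finset.subset_biUnion_of_mem G (mem_outEdges.2 he)).trans
      (Finset.subset_union_right.trans Finset.subset_union_right)
  have hstart : ∀ I ∈ Φ, I.1 ∈ S := fun I hI => by
    rw [← Finset.mem_coe, hS]; exact ⟨I, hI, rfl⟩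
  have hpos : ∀ I ∈ Φ, 0 ≤ I.1 := fun I hI => hlo.trans (hΦ.le_start I hI)
  have hloS : lo ∈ S := by
    rw [← Finset.mem_coe, hS]; exact hΦ.lo_mem hlohi
  have hdep : ∀ e, N.src e = v → ∀ I ∈ Φ, N.depletionTime f e I.1 ∈ X' := fun e he I hI =>
    hGX e he (Finset.mem_union_left _ (Finset.mem_image_of_mem _ (hstart I hI)))
  have hshift : ∀ e, N.src e = v → ∀ a ∈ S, a + N.transit e ∈ X' := fun e he a ha =>
    hGX e he (Finset.mem_union_right _ (Finset.mem_union_left _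
      (Finset.mem_image_of_mem (fun a => a + N.transit e) ha)))
  have hdepshift : ∀ e, N.src e = v → ∀ I ∈ Φ, N.depletionTime f e I.1 + N.transit e ∈ X' :=
    fun e he I hI => hGX e he (Finset.mem_union_right _ (Finset.mem_union_right _
      (Finset.mem_image_of_mem (fun a => N.depletionTime f e a + N.transit e) (hstart I hI))))
  have hphase : ∀ s t, lo ≤ s → s < t → t ≤ hi → (∀ x ∈ X', x ∉ Ioo s t) →
      ∃ I ∈ Φ, I.1 ≤ s ∧ t ≤ I.2 := by
    intro s t hs hst ht hd
    refine hΦ.exists_phase hs hst ht fun x hx => hd x (hSX ?_)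
    rwa [← Finset.mem_coe, hS]
  -- As `lo` is itself a break point, no piece straddles the old horizon: it lies where regularity
  -- is already known or within the new pass.
  have hsplit : ∀ s t, (∀ x ∈ X', x ∉ Ioo s t) → t ≤ lo ∨ lo ≤ s := by
    intro s t hd
    by_contra hcon
    push Not at hcon
    exact hd lo (hSX hloS) ⟨hcon.2, hcon.1⟩
  refine ⟨X', ?_, ?_⟩
  · have hGc : ∀ e ∈ N.outEdges v, (G e).card ≤ 3 * S.card := by
      intro e _
      have h1 := Finset.card_union_le (S.image (N.depletionTime f e))
        (S.image (fun a => a + N.transit e) ∪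
          S.image (fun a => N.depletionTime f e a + N.transit e))
      have h2 := Finset.card_union_le (S.image (fun a => a + N.transit e))
        (S.image (fun a => N.depletionTime f e a + N.transit e))
      have h3 := Finset.card_image_le (s := S) (f := N.depletionTime f e)
      have h4 := Finset.card_image_le (s := S) (f := fun a => a + N.transit e)
      have h5 := Finset.card_image_le (s := S) (f := fun a => N.depletionTime f e a + N.transit e)
      simp only [hG]
      omega
    have h1 := Finset.card_union_le X (S ∪ (N.outEdges v).biUnion G)
    have h2 := Finset.card_union_le S ((N.outEdges v).biUnion G)
    have h3 := Finset.card_biUnion_le_card_mul _ G _ hGc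
    rw [hX']
    nlinarith
  constructor
  · intro e s t hs hst ht hd
    by_cases he : N.src e = v
    · rw [he, Function.update_self] at ht
      rcases hsplit s t hd with h1 | h1
      · exact (hr.inRate e).mono hX s t hs hst (by rwa [he, hH]) hd
      · obtain ⟨I, hI, h2, h3⟩ := hphase s t h1 hst ht hd
        intro θ hθ
        rw [(hΦ.maximal I hI).inRate_const e he θ ⟨h2.trans hθ.1, hθ.2.trans_le h3⟩,
          (hΦ.maximal I hI).inRate_const e he s ⟨h2, hst.trans_le h3⟩]
    · rw [Function.update_of_ne he] at ht
      exact (hr.inRate e).mono hX s t hs hst ht hd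
  · intro e s t hs hst ht hd
    by_cases he : N.src e = v
    · rw [he, Function.update_self] at ht
      by_cases h1 : t ≤ lo + N.transit e
      · exact (hr.outRate e).mono hX s t hs hst (by rwa [he, hH]) hd
      · have h2 : lo ≤ s - N.transit e := by
          by_contra hcon
          exact hd _ (hshift e he lo hloS) ⟨by linarith, not_le.1 h1⟩
        have hconv : ∀ x, x + N.transit e ∈ X' → x ∉ Ioo (s - N.transit e) (t - N.transit e) :=
          fun x hx hx' => hd _ hx ⟨by linarith [hx'.1], by linarith [hx'.2]⟩
        obtain ⟨I, hI, h3, h4⟩ := hΦ.exists_phase (t := t - N.transit e) h2 (by linarith)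
          (by linarith) (by
            intro x hx
            rw [← hS] at hx
            exact hconv x (hshift e he x hx))
        have h5 := (hΦ.maximal I hI).outRate_const hf.1 (hpos I hI) he h3 (by linarith) h4
          (hconv _ (hdepshift e he I hI))
        intro θ hθ
        have := h5 (θ - N.transit e) ⟨by linarith [hθ.1], by linarith [hθ.2]⟩
        simpa using this
    · rw [Function.update_of_ne he] at ht
      exact (hr.outRate e).mono hX s t hs hst ht hd
  · intro w s t hs hst ht hd
    by_cases hw : w = v
    · subst hw
      rw [Function.update_self] at ht
      rcases hsplit s t hd with h1 | h1
      · exact (hr.label w).mono hX s t hs hst (by rwa [hH]) hd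
      · obtain ⟨I, hI, h2, h3⟩ := hphase s t h1 hst ht hd
        have hP := hΦ.maximal I hI
        obtain ⟨e, he, hact⟩ := hP.exists_active hN hf.1 hv (hpos I hI)
        obtain ⟨m, hm⟩ := hP.queue_affine hf.1 (hpos I hI) he h2 hst h3 (hd _ (hdep e he I hI))
        obtain ⟨p, hp⟩ := (hr.label (N.dst e)).mono hX s t hs hst (ht.trans (hsucc e he)) hd
        have hlab : ∀ θ ∈ Icc s t, N.label f w θ = N.edgeTime f e θ := fun θ hθ => by
          rw [mem_activeEdges.1 (hact θ ⟨h2.trans hθ.1, hθ.2.trans h3⟩), he]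
        refine ⟨p + m / N.cap e, fun θ hθ => ?_⟩
        rw [hlab θ hθ, hlab s ⟨le_rfl, hst.le⟩]
        unfold edgeTime cost
        rw [hp θ hθ, hm θ hθ]
        ring
    · rw [Function.update_of_ne hw] at ht
      exact (hr.label w).mono hX s t hs hst ht hd
  · intro e s t hs ht hd θ hθ θ' hθ'
    have hst : s < t := hθ.1.trans hθ.2
    by_cases he : N.src e = v
    · rw [he, Function.update_self] at ht
      rcases hsplit s t hd with h1 | h1
      · exact hr.active e s t hs (by rwa [he, hH]) (fun x hx => hd x (hX hx)) θ hθ θ' hθ'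
      · obtain ⟨I, hI, h2, h3⟩ := hphase s t h1 hst ht hd
        exact (hΦ.maximal I hI).active_iff hN hf.1 (hpos I hI) he
          ⟨h2.trans_lt hθ.1, hθ.2.trans_le h3⟩ ⟨h2.trans_lt hθ'.1, hθ'.2.trans_le h3⟩
    · rw [Function.update_of_ne he] at ht
      exact hr.active e s t hs ht (fun x hx => hd x (hX hx)) θ hθ θ' hθ'
  · exact fun w T => (hr.inflow w T).mono hX

end RegularUpTo

end SingleSinkNetwork

theorem stepOn_of_jumpTimes_subset {α : Type*} {g : ℝ → α} {X : Finset ℝ}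
    (hX : jumpTimes g ⊆ X) (hright : ∀ θ, 0 ≤ θ → ∀ᶠ x in 𝓝[≥] θ, g x = g θ) (T : ℝ) :
    StepOn X T g := by
  intro s t hs hst _ hd θ hθ
  rcases hθ.1.eq_or_lt with rfl | hsθ
  · rfl
  -- With the discrete topology, local constancy is continuity, so `g` is constant on the connected
  -- set `(s, t)`.
  let _ : TopologicalSpace α := ⊥
  have : DiscreteTopology α := ⟨rfl⟩
  have hc : ContinuousOn g (Ioo s t) := by
    intro x hx
    refine ContinuousAt.continuousWithinAt ?_
    have h1 : ∀ᶠ y in 𝓝 x, g y = g x := by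
      by_contra hcon
      exact hd x (hX ⟨hs.trans_lt hx.1, hcon⟩) hx
    exact continuousAt_const.congr (h1.mono fun y hy => hy.symm)
  obtain ⟨y, hy, hys⟩ := (((hright s hs).filter_mono
    (nhdsWithin_mono s Ioi_subset_Ici_self)).and (Ioo_mem_nhdsGT hst)).exists
  rw [← hy]
  exact isPreconnected_Ioo.constant hc ⟨hsθ, hθ.2⟩ hys

namespace SingleSinkNetwork

variable {V E : Type*} {N : SingleSinkNetwork V E} {f : FlowOverTime E}

section inflow

variable [Finite V]

theorem finite_jumpTimes_inflow (N : SingleSinkNetwork V E) :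
    (jumpTimes (fun θ v => N.inflow v θ)).Finite := by
  refine (finite_iUnion N.inflow_finite_jumps).subset ?_
  rintro θ ⟨h0, h⟩
  rw [mem_iUnion]
  by_contra hcon
  push Not at hcon
  refine h ?_
  have h1 : ∀ v, ∀ᶠ x in 𝓝 θ, N.inflow v x = N.inflow v θ := fun v => by
    by_contra hc
    exact hcon v ⟨h0, hc⟩
  exact (eventually_all.2 h1).mono fun x hx => funext hx

theorem regularUpTo_zero [Fintype E] (hf : N.IsFeasible f) :
    N.RegularUpTo f N.finite_jumpTimes_inflow.toFinset (fun _ => 0) where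
  inRate _ s t hs hst ht := absurd (hst.trans_le ht) (not_lt.2 hs)
  outRate e s t hs hst ht _ θ hθ := by
    rw [zero_add] at ht
    rw [hf.no_early_outflow e θ (hs.trans hθ.1) (hθ.2.trans_le ht),
      hf.no_early_outflow e s hs (hst.trans_le ht)]
  label _ s t hs hst ht := absurd (hst.trans_le ht) (not_lt.2 hs)
  active _ s t hs ht _ θ hθ := absurd ((hθ.1.trans hθ.2).trans_le ht) (not_lt.2 hs)
  inflow v T := by
    have h : StepOn N.finite_jumpTimes_inflow.toFinset T (fun θ v => N.inflow v θ) := by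
      refine stepOn_of_jumpTimes_subset (by simp) (fun θ hθ => ?_) T
      exact (eventually_all.2 fun v => N.inflow_right_constant v θ hθ).mono
        fun x hx => funext hx
    exact fun s t hs hst ht hd θ hθ => congrFun (h s t hs hst ht hd θ hθ) v

end inflow

section tauMin

variable [Fintype E] [Nonempty E]

theorem tauMin_le (N : SingleSinkNetwork V E) (e : E) : N.tauMin ≤ N.transit e :=
  Finset.inf'_le _ (Finset.mem_univ e)

theorem tauMin_pos (N : SingleSinkNetwork V E) : 0 < N.tauMin := by
  unfold tauMin
  rw [Finset.lt_inf'_iff]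
  exact fun e _ => N.transit_pos e

theorem lt_lastPass_add_one_mul (N : SingleSinkNetwork V E) (T : ℝ) :
    T < ((N.lastPass T : ℝ) + 1) * N.tauMin := by
  rw [← div_lt_iff₀ N.tauMin_pos]
  exact Nat.lt_floor_add_one _

theorem lastPass_mul_le (N : SingleSinkNetwork V E) {T : ℝ} (hT : 0 ≤ T) :
    (N.lastPass T : ℝ) * N.tauMin ≤ T := by
  rw [← le_div_iff₀ N.tauMin_pos]
  exact Nat.floor_le (div_nonneg hT N.tauMin_pos.le)

/-- The last pass starts less than `τ_min` before `T`, so nothing that enters an edge from then on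
can leave it before `T`. -/
theorem le_add_transit (N : SingleSinkNetwork V E) {T : ℝ} (e : E) {θ : ℝ} (h : (N.lastPass T : ℝ) * N.tauMin ≤ θ) :
    0 ≤ θ ∧ T ≤ θ + N.transit e := by
  have h1 := N.lt_lastPass_add_one_mul T
  have h2 := N.tauMin_le e
  exact ⟨(mul_nonneg (Nat.cast_nonneg _) N.tauMin_pos.le).trans h, by linarith⟩

end tauMin

theorem card_outEdges_le [Fintype V] [Fintype E] (N : SingleSinkNetwork V E) (v : V) :
    (N.outEdges v).card ≤ N.maxOutDegree :=
  Finset.le_sup (f := fun v => (N.outEdges v).card) (Finset.mem_univ v)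

theorem maxOutDegree_pos [Fintype V] [Fintype E] [Nonempty E] (N : SingleSinkNetwork V E) :
    1 ≤ N.maxOutDegree := by
  obtain ⟨e⟩ := ‹Nonempty E›
  refine le_trans ?_ (N.card_outEdges_le (N.src e))
  exact Finset.card_pos.2 ⟨e, mem_outEdges.2 rfl⟩

/-! ### The network after the last particle has arrived -/

section termination

variable [Fintype E] {T : ℝ}

/-- The chain `F⁺(θ) ≥ F⁻(θ + τ) ≥ F⁻(T) = F⁺(T) ≥ F⁺(θ)` consists of equalities. -/
theorem TerminatesBy.queue_and_cumIn (hT : N.TerminatesBy f T) (hf : N.IsFeasible f) {e : E}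
    {θ : ℝ} (hθ : 0 ≤ θ) (h1 : T ≤ θ + N.transit e) (h2 : θ ≤ T) :
    N.queue f e θ = 0 ∧ f.cumIn e θ = f.cumIn e T := by
  have a1 := hf.queue_nonneg e hθ
  have a2 := f.cumOut_mono e (hθ.trans h2) h1
  have a3 := f.cumIn_mono e hθ h2
  have a4 := hT.2 e
  unfold queue at a1 ⊢
  constructor <;> linarith

/-- Termination only speaks of the single time `T`. Since queues are empty at `T`, no edge has
outflow until its travel time has passed; without network inflow, conservation then leaves nothing
that could enter an edge. -/
theorem TerminatesBy.extend [Nonempty E] (hT : N.TerminatesBy f T) (hN : N.Acyclic)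
    (hf : N.IsFeasible f)
    (hT0 : 0 ≤ T) {T' : ℝ} (h1 : T ≤ T') (h2 : T' ≤ T + N.tauMin) : N.TerminatesBy f T' := by
  have hT0' := hT0.trans h1
  have hout : ∀ e, f.cumOut e T' = f.cumOut e T := by
    intro e
    have hq := (hT.queue_and_cumIn hf hT0 (by linarith [N.transit_pos e]) le_rfl (e := e)).1
    have a1 := f.cumOut_mono e hT0' (h2.trans (add_le_add le_rfl (N.tauMin_le e)))
    have a2 := f.cumOut_mono e hT0 h1
    have a3 := hT.2 e
    unfold queue at hq
    linarith
  refine ⟨fun v θ hθ => hT.1 v θ (h1.trans hθ), fun e => ?_⟩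
  have hle : f.cumIn e T' - f.cumIn e T ≤ 0 := by
    rw [f.cumIn_sub e hT0 hT0']
    have hsum : ∫ ζ in T..T', ∑ e' ∈ N.inEdges (N.src e), f.outRate e' ζ = 0 := by
      rw [intervalIntegral.integral_finsetSum
        fun e' _ => f.intervalIntegrable_outRate e' hT0 hT0']
      refine Finset.sum_eq_zero fun e' _ => ?_
      rw [← f.cumOut_sub e' hT0 hT0', hout e', sub_self]
    have hint : IntervalIntegrable
        (fun ζ => ∑ e' ∈ N.inEdges (N.src e), f.outRate e' ζ) volume T T' := by
      have h : (fun ζ => ∑ e' ∈ N.inEdges (N.src e), f.outRate e' ζ) =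
          ∑ e' ∈ N.inEdges (N.src e), f.outRate e' := by
        ext ζ; simp
      rw [h]
      exact IntervalIntegrable.sum _ fun e' _ => f.intervalIntegrable_outRate e' hT0 hT0'
    rw [← hsum]
    refine intervalIntegral.integral_mono_on h1 (f.intervalIntegrable_inRate e hT0 hT0')
      hint ?_
    intro ζ hζ
    have hζ0 := hT0.trans hζ.1
    have hcons := hf.conservation (N.src e) (hN.src_ne_sink e) ζ hζ0
    rw [hT.1 _ ζ hζ.1] at hcons
    have := Finset.single_le_sum (f := fun e => f.inRate e ζ)
      (fun e' _ => f.inRate_nonneg e' ζ hζ0) (mem_outEdges.2 (rfl : N.src e = N.src e))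
    linarith
  have := f.cumIn_mono e hT0 h1
  linarith [hout e, hT.2 e]

variable [Nonempty E]

theorem TerminatesBy.mono (hT : N.TerminatesBy f T) (hN : N.Acyclic) (hf : N.IsFeasible f)
    (hT0 : 0 ≤ T) {T' : ℝ} (h1 : T ≤ T') : N.TerminatesBy f T' := by
  have key : ∀ n : ℕ, N.TerminatesBy f (T + n * N.tauMin) := by
    intro n
    induction n with
    | zero => simpa using hT
    | succ n ih =>
      have hn : 0 ≤ (n : ℝ) * N.tauMin := mul_nonneg n.cast_nonneg N.tauMin_pos.le
      refine ih.extend hN hf (add_nonneg hT0 hn) ?_ ?_ <;> push_cast <;>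
        linarith [N.tauMin_pos]
  have hd : 0 ≤ (T' - T) / N.tauMin := div_nonneg (sub_nonneg.2 h1) N.tauMin_pos.le
  have hlow := Nat.floor_le hd
  have hup := (Nat.lt_floor_add_one ((T' - T) / N.tauMin)).le
  rw [le_div_iff₀ N.tauMin_pos] at hlow
  rw [div_le_iff₀ N.tauMin_pos] at hup
  exact (key _).extend hN hf
    (add_nonneg hT0 (mul_nonneg (Nat.cast_nonneg _) N.tauMin_pos.le)) (by linarith) (by linarith)

theorem TerminatesBy.queue_eq_zero (hT : N.TerminatesBy f T) (hN : N.Acyclic)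
    (hf : N.IsFeasible f) (hT0 : 0 ≤ T) {e : E} {θ : ℝ} (hθ : 0 ≤ θ)
    (h : T ≤ θ + N.transit e) : N.queue f e θ = 0 :=
  ((hT.mono hN hf hT0 (le_max_left T θ)).queue_and_cumIn hf hθ
    (max_le h (by linarith [N.transit_pos e])) (le_max_right T θ)).1

/-- Constancy of the cumulative inflow only makes the rate vanish almost everywhere; right-constancy
of the rate upgrades this to the time `θ` itself. -/
theorem TerminatesBy.inRate_eq_zero (hT : N.TerminatesBy f T) (hN : N.Acyclic)
    (hf : N.IsFeasible f) (hT0 : 0 ≤ T) {e : E} {θ b : ℝ} (hθ : 0 ≤ θ)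
    (h : T ≤ θ + N.transit e) (hb : θ < b) (hc : ∀ y ∈ Ico θ b, f.inRate e y = f.inRate e θ) :
    f.inRate e θ = 0 := by
  have hτ := N.transit_pos e
  set b' := min b (θ + N.transit e)
  have hb' : θ < b' := lt_min hb (by linarith)
  have hb'' : b' ≤ θ + N.transit e := min_le_right _ _
  have hT' := hT.mono hN hf hT0 (le_max_left T b')
  have e1 := (hT'.queue_and_cumIn hf hθ (max_le h hb'') (hb'.le.trans (le_max_right T b'))).2
  have e2 := (hT'.queue_and_cumIn hf (hθ.trans hb'.le) (e := e)
    (max_le (by linarith) (by linarith)) (le_max_right T b')).2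
  have e3 := f.cumIn_sub e hθ (hθ.trans hb'.le)
  rw [e1, e2, sub_self, intervalIntegral.integral_of_le hb'.le, integral_Ioc_eq_integral_Ioo,
    setIntegral_congr_fun measurableSet_Ioo (g := fun _ => f.inRate e θ)
    (fun y hy => hc y ⟨hy.1.le, hy.2.trans_le (min_le_left _ _)⟩)] at e3
  simp only [integral_const, smul_eq_mul, MeasurableSet.univ, measureReal_restrict_apply,
    univ_inter] at e3
  rcases mul_eq_zero.1 e3.symm with h1 | h1
  · have h2 := h1.symm.trans (Real.volume_real_Ioo_of_le hb'.le)
    linarith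
  · exact h1

/-- A flow without particles whose rates are right-constant up to a later time is constantly zero
from then on. -/
theorem TerminatesBy.rates_eq_zero (hT : N.TerminatesBy f T) (hN : N.Acyclic)
    (hf : N.IsFeasible f) (hT0 : 0 ≤ T) {M : ℝ} (hM : T < M)
    (hc : ∀ e, ∀ θ, 0 ≤ θ → θ < M → ∃ b, θ < b ∧ ∀ y ∈ Ico θ b, f.inRate e y = f.inRate e θ) :
    (∀ e θ, T ≤ θ → f.outRate e θ = 0) ∧
      ∀ e θ, 0 ≤ θ → T ≤ θ + N.transit e → f.inRate e θ = 0 := by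
  have hcons : ∀ θ, T ≤ θ → (∀ e, f.outRate e θ = 0) → ∀ e, f.inRate e θ = 0 := by
    intro θ hθ hout e
    have h1 := hf.conservation (N.src e) (hN.src_ne_sink e) θ (hT0.trans hθ)
    rw [Finset.sum_eq_zero fun e' _ => hout e', hT.1 _ θ hθ, sub_zero] at h1
    exact (Finset.sum_eq_zero_iff_of_nonneg
      fun e' _ => f.inRate_nonneg e' θ (hT0.trans hθ)).1 h1 e (mem_outEdges.2 rfl)
  have hin : ∀ e θ, 0 ≤ θ → T ≤ θ + N.transit e → θ < M → f.inRate e θ = 0 := by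
    intro e θ h0 h1 h2
    obtain ⟨b, hb, hcb⟩ := hc e θ h0 h2
    exact hT.inRate_eq_zero hN hf hT0 h0 h1 hb hcb
  -- Beyond `M` right-constancy is unknown, so vanishing is propagated pointwise in steps of
  -- `τ_min`: zero outflow into a node gives zero inflow into its edges, and this gives zero outflow
  -- one travel time later.
  have hout : ∀ n : ℕ, ∀ θ, T ≤ θ → θ < T + n * N.tauMin → ∀ e, f.outRate e θ = 0 := by
    intro n
    induction n with
    | zero =>
      intro θ h1 h2
      simp only [Nat.cast_zero, zero_mul, add_zero] at h2
      exact absurd h2 (not_lt.2 h1)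
    | succ n ih =>
      intro θ h1 h2 e
      have hθ0 := hT0.trans h1
      push_cast at h2
      rcases lt_or_ge θ (N.transit e) with h3 | h3
      · exact hf.no_early_outflow e θ hθ0 h3
      have hs0 : 0 ≤ θ - N.transit e := sub_nonneg.2 h3
      have hsT : T ≤ θ - N.transit e + N.transit e := by linarith
      have hrate : f.inRate e (θ - N.transit e) = 0 := by
        rcases lt_or_ge (θ - N.transit e) M with h4 | h4
        · exact hin e _ hs0 hsT h4
        · have h5 := hM.le.trans h4
          exact hcons _ h5 (ih _ h5 (by linarith [N.tauMin_le e])) e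
      have h6 := hf.at_capacity_of_no_queue e _ hs0 (hT.queue_eq_zero hN hf hT0 hs0 hsT).le
      rw [hrate, min_eq_left (N.cap_pos e).le, sub_add_cancel] at h6
      exact h6
  have hout' : ∀ e θ, T ≤ θ → f.outRate e θ = 0 := by
    intro e θ hθ
    obtain ⟨n, hn⟩ := exists_nat_gt ((θ - T) / N.tauMin)
    rw [div_lt_iff₀ N.tauMin_pos] at hn
    exact hout n θ hθ (by linarith) e
  refine ⟨hout', fun e θ h0 h1 => ?_⟩
  rcases lt_or_ge θ M with h4 | h4
  · exact hin e θ h0 h1 h4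
  · exact hcons θ (hM.le.trans h4) (fun e => hout' e θ (hM.le.trans h4)) e

end termination

theorem label_congr {θ θ' : ℝ} (h : ∀ e, N.cost f e θ = N.cost f e θ') (v : V) :
    N.label f v θ = N.label f v θ' := by
  have h1 : (fun e => N.cost f e θ) = fun e => N.cost f e θ' := funext h
  unfold label
  rw [h1]

theorem activeEdges_congr {θ θ' : ℝ} (h : ∀ e, N.cost f e θ = N.cost f e θ') :
    N.activeEdges f θ = N.activeEdges f θ' := by
  unfold activeEdges
  simp only [h, label_congr h]

end SingleSinkNetwork

/-- The factor by which the number of events grows when one node is processed in one pass. -/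
theorem growth_factor_le {d : ℕ} (hd : 1 ≤ d) :
    1 + 2 * d * 4 ^ d * (3 * d + 2) ≤ 2 * (d + 1) ^ (4 ^ d + 1) := by
  rcases hd.eq_or_lt with rfl | hd2
  · norm_num
  have hy : 16 ≤ 4 ^ d := by
    calc 16 = 4 ^ 2 := by norm_num
      _ ≤ 4 ^ d := Nat.pow_le_pow_right (by norm_num) hd2
  set y := 4 ^ d with hydef
  clear_value y
  -- With `y = 4 ^ d`, the left side is at most `6 * y * (d + 1) ^ 2`, and `6 * y ≤ 2 ^ y ≤ 2 * (d +
  -- 1) ^ (y - 1)`.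
  have h1 : ∀ n : ℕ, 5 ≤ n → 6 * n ≤ 2 ^ n := by
    intro n hn
    induction n, hn using Nat.le_induction with
    | base => norm_num
    | succ n hn ih => rw [pow_succ]; omega
  obtain ⟨z, rfl⟩ : ∃ z, y = z + 1 := ⟨y - 1, by omega⟩
  have h2 := h1 (z + 1) (by omega)
  have h3 : 2 ^ z ≤ (d + 1) ^ z := Nat.pow_le_pow_left (by omega) z
  have h4 : 2 * (d + 1) ^ (z + 1 + 1) = (d + 1) ^ 2 * (2 * (d + 1) ^ z) := by ring
  rw [h4]
  calc 1 + 2 * d * (z + 1) * (3 * d + 2) ≤ (d + 1) ^ 2 * (6 * (z + 1)) := by nlinarith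
    _ ≤ (d + 1) ^ 2 * (2 * (d + 1) ^ z) := by
      refine Nat.mul_le_mul_left _ (h2.trans ?_)
      rw [pow_succ]
      omega

/-- Each of the `s` new local phases brings at most `1 + 3 * d` break points and one entry in the
list of phases, `3 * d + 2` in all, and `s` is proportional to `x + 1`. -/
theorem growth_step {x l s c d D B : ℕ} (hdD : d ≤ D) (hs : s ≤ (x + 1) * (2 * d * 4 ^ d))
    (hc : c ≤ x + s * (1 + 3 * d)) (hB : 1 + 2 * D * 4 ^ D * (3 * D + 2) ≤ B) :
    c + 1 + (l + s) ≤ (x + 1 + l) * B := by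
  have h1 : 2 * d * 4 ^ d ≤ 2 * D * 4 ^ D :=
    Nat.mul_le_mul (Nat.mul_le_mul_left 2 hdD) (Nat.pow_le_pow_right (by norm_num) hdD)
  have h2 : s ≤ (x + 1) * (2 * D * 4 ^ D) := hs.trans (Nat.mul_le_mul_left _ h1)
  have h3 : s * (3 * d + 2) ≤ (x + 1) * (2 * D * 4 ^ D) * (3 * D + 2) :=
    Nat.mul_le_mul h2 (by omega)
  have h4 : (x + 1 + l) * (1 + 2 * D * 4 ^ D * (3 * D + 2)) ≤ (x + 1 + l) * B :=
    Nat.mul_le_mul_left _ hB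
  have h5 : 0 ≤ l * (2 * D * 4 ^ D * (3 * D + 2)) := Nat.zero_le _
  calc c + 1 + (l + s) ≤ (x + 1) + l + s * (3 * d + 2) := by
        have : s * (3 * d + 2) = s * (1 + 3 * d) + s := by ring
        omega
    _ ≤ (x + 1) + l + (x + 1) * (2 * D * 4 ^ D) * (3 * D + 2) := by omega
    _ ≤ (x + 1 + l) * (1 + 2 * D * 4 ^ D * (3 * D + 2)) := by nlinarith
    _ ≤ _ := h4

/-! ### Induction over passes and nodes -/

namespace SingleSinkNetwork

variable {V E : Type*} [Fintype V] [Fintype E] [Nonempty E] {N : SingleSinkNetwork V E} {T : ℝ}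

/-- The base of the exponential bound on the number of phases. -/
noncomputable def growthFactor (N : SingleSinkNetwork V E) : ℕ :=
  2 * (N.maxOutDegree + 1) ^ (4 ^ N.maxOutDegree + 1)

namespace AcyclicRun

variable (R : N.AcyclicRun T)

/-- The time up to which the flow leaving a node has been computed when the nodes before the `i`-th
one have been processed in pass `k`. -/
noncomputable def horizon (k i : ℕ) (v : V) : ℝ :=
  (if (R.order v : ℕ) < i then (k : ℝ) + 1 else k) * N.tauMin

theorem horizon_last (k : ℕ) (v : V) :
    R.horizon k (Fintype.card V) v = R.horizon (k + 1) 0 v := by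
  simp [horizon]

theorem isPhaseCover {v : V} (hv : v ≠ N.sink) {k : ℕ} (hk : k ≤ N.lastPass T) :
    N.IsPhaseCover R.flow v ((k : ℝ) * N.tauMin) (((k : ℝ) + 1) * N.tauMin) (R.phases v k) where
  le_start := R.phases_start v hv k hk
  maximal := R.phases_maximal v hv k hk
  cover := R.phases_cover v hv k hk

/-- All events of a run up to some stage are contained in the finite sets `X` and `L`. -/
def StageBound (k i : ℕ) : Prop :=
  ∃ (X : Finset ℝ) (L : Finset (V × ℕ × ℝ × ℝ)),
    X.card + 1 + L.card ≤ N.numInflowIntervals * N.growthFactor ^ (Fintype.card V * k + i) ∧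
    N.RegularUpTo R.flow X (R.horizon k i) ∧
    ∀ x ∈ R.localPhases, (x.2.1 < k ∨ x.2.1 = k ∧ (R.order x.1 : ℕ) < i) → x ∈ L

theorem stageBound_zero : R.StageBound 0 0 := by
  refine ⟨N.finite_jumpTimes_inflow.toFinset, ∅, ?_, ?_, ?_⟩
  · simp [numInflowIntervals, ncard_eq_toFinset_card _ N.finite_jumpTimes_inflow]
  · have : R.horizon 0 0 = fun _ => 0 := by
      funext v; simp [horizon]
    rw [this]
    exact regularUpTo_zero R.isIDE.1
  · intro x _ h
    omega

theorem stageBound_succ (hN : N.Acyclic) {k i : ℕ} (hk : k ≤ N.lastPass T)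
    (hi : i < Fintype.card V) (h : R.StageBound k i) : R.StageBound k (i + 1) := by
  classical
  obtain ⟨X, L, hcard, hreg, hL⟩ := h
  have hτ := N.tauMin_pos
  set v : V := R.order.symm ⟨i, hi⟩ with hvdef
  have hvi : (R.order v : ℕ) = i := by simp [hvdef]
  have heq : ∀ w, (R.order w : ℕ) = i → w = v := by
    intro w hw
    rw [hvdef, Equiv.eq_symm_apply]
    exact Fin.ext hw
  have hH : R.horizon k (i + 1) =
      Function.update (R.horizon k i) v (((k : ℝ) + 1) * N.tauMin) := by
    funext w
    by_cases hw : w = v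
    · subst hw
      simp [horizon, hvi]
    · have hne : (R.order w : ℕ) ≠ i := fun h => hw (heq w h)
      rw [Function.update_of_ne hw, horizon, horizon]
      congr 1
      refine if_congr ?_ rfl rfl
      omega
  have hB := growth_factor_le N.maxOutDegree_pos
  have hBpos : 1 ≤ N.growthFactor := by unfold growthFactor; omega
  have hgoal : (X.card + 1 + L.card) * N.growthFactor ≤
      N.numInflowIntervals * N.growthFactor ^ (Fintype.card V * k + (i + 1)) := by
    rw [← add_assoc, pow_succ, ← mul_assoc]
    exact Nat.mul_le_mul_right _ hcard
  -- The sink has label zero and no outgoing edges, so its turn creates neither break points nor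
  -- phases.
  by_cases hv : v = N.sink
  · refine ⟨X, L, (Nat.le_mul_of_pos_right _ hBpos).trans hgoal, ?_, ?_⟩
    · rw [hH, hv]
      exact hreg.update_sink hN _
    · intro x hx hxi
      refine hL x hx (hxi.imp_right fun h => ⟨h.1, ?_⟩)
      have : (R.order x.1 : ℕ) ≠ i := fun h => hx.1 (hv ▸ heq x.1 h)
      omega
  · have hΦ := R.isPhaseCover hv hk
    have hk0 : 0 ≤ (k : ℝ) * N.tauMin := mul_nonneg k.cast_nonneg hτ.le
    have hsucc : ∀ e, N.src e = v → ((k : ℝ) + 1) * N.tauMin ≤ R.horizon k i (N.dst e) := by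
      intro e he
      have := R.order_topological e
      rw [he, Fin.lt_def, hvi] at this
      simp [horizon, this]
    -- Tails of incoming edges may still await this pass, but the previous passes together with the
    -- travel time already reach its end.
    have hpred : ∀ e, N.dst e = v →
        ((k : ℝ) + 1) * N.tauMin ≤ R.horizon k i (N.src e) + N.transit e := by
      intro e _
      have h1 : (k : ℝ) * N.tauMin ≤ R.horizon k i (N.src e) := by
        refine mul_le_mul_of_nonneg_right ?_ hτ.le
        split_ifs <;> linarith
      linarith [N.tauMin_le e]
    have hle := hΦ.encard_le hN R.isIDE hv hk0 hreg hsucc hpred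
    have hfin : (R.phases v k).Finite := finite_of_encard_le_coe hle
    have hΦcard : hfin.toFinset.card ≤
        (X.card + 1) * (2 * (N.outEdges v).card * 4 ^ (N.outEdges v).card) := by
      rw [hfin.encard_eq_coe_toFinset_card] at hle
      exact_mod_cast hle
    obtain ⟨X', hX', hreg'⟩ := hreg.step hN R.isIDE hΦ hv hk0 (by linarith)
      (by simp [horizon, hvi]) hsucc (S := hfin.toFinset.image Prod.fst) (by simp)
    have hScard : (hfin.toFinset.image Prod.fst).card ≤ hfin.toFinset.card :=
      Finset.card_image_le
    refine ⟨X', L ∪ hfin.toFinset.image fun I => (v, k, I), ?_, ?_, ?_⟩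
    · refine le_trans ?_ hgoal
      have hL' : (L ∪ hfin.toFinset.image fun I => (v, k, I)).card ≤
          L.card + hfin.toFinset.card :=
        (Finset.card_union_le _ _).trans (add_le_add le_rfl Finset.card_image_le)
      refine le_trans (add_le_add le_rfl hL') ?_
      exact growth_step (N.card_outEdges_le v) hΦcard
        (hX'.trans (add_le_add le_rfl (Nat.mul_le_mul_right _ hScard))) hB
    · rw [hH]
      exact hreg'
    · rintro ⟨w, k', I⟩ hx hxi
      rw [Finset.mem_union]
      by_cases hw : k' = k ∧ w = v
      · obtain ⟨rfl, rfl⟩ := hw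
        exact Or.inr (Finset.mem_image.2 ⟨I, hfin.mem_toFinset.2 hx.2.2, rfl⟩)
      · refine Or.inl (hL _ hx (hxi.imp_right fun h => ⟨h.1, ?_⟩))
        have : (R.order w : ℕ) ≠ i := fun h' => hw ⟨h.1, heq w h'⟩
        have h2 : (R.order w : ℕ) < i + 1 := h.2
        change (R.order w : ℕ) < i
        omega

theorem stageBound (hN : N.Acyclic) {k : ℕ} (hk : k ≤ N.lastPass T) : R.StageBound k 0 := by
  induction k with
  | zero => exact R.stageBound_zero
  | succ k ih =>
    have key : ∀ i, i ≤ Fintype.card V → R.StageBound k i := by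
      intro i
      induction i with
      | zero => exact fun _ => ih (by omega)
      | succ i ih' => exact fun hi => R.stageBound_succ hN (by omega) hi (ih' (by omega))
    obtain ⟨X, L, h1, h2, h3⟩ := key _ le_rfl
    refine ⟨X, L, ?_, ?_, ?_⟩
    · rwa [mul_add, mul_one, add_zero]
    · rwa [← funext (R.horizon_last k)]
    · intro x hx hxk
      refine h3 x hx ?_
      have := (R.order x.1).2
      omega

theorem exists_inRate_const (hN : N.Acyclic) (e : E) {θ : ℝ} (h0 : 0 ≤ θ)
    (h1 : θ < ((N.lastPass T : ℝ) + 1) * N.tauMin) :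
    ∃ b, θ < b ∧ ∀ y ∈ Ico θ b, R.flow.inRate e y = R.flow.inRate e θ := by
  have hτ := N.tauMin_pos
  have hd : 0 ≤ θ / N.tauMin := div_nonneg h0 hτ.le
  have hlow := Nat.floor_le hd
  have hup := Nat.lt_floor_add_one (θ / N.tauMin)
  have hk : ⌊θ / N.tauMin⌋₊ ≤ N.lastPass T := by
    refine Nat.lt_succ_iff.1 ((Nat.floor_lt hd).2 ?_)
    rw [div_lt_iff₀ hτ]
    exact_mod_cast h1
  rw [le_div_iff₀ hτ] at hlow
  rw [div_lt_iff₀ hτ] at hup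
  have hΦ := R.isPhaseCover (hN.src_ne_sink e) hk
  obtain ⟨I, ⟨hI, hθ⟩, _⟩ := hΦ.cover θ ⟨hlow, hup⟩
  refine ⟨I.2, hθ.2, fun y hy => ?_⟩
  rw [(hΦ.maximal I hI).inRate_const e rfl θ hθ,
    (hΦ.maximal I hI).inRate_const e rfl y ⟨hθ.1.trans hy.1, hy.2⟩]

theorem terminatesBy : N.TerminatesBy R.flow T := R.horizon_large R.flow R.isIDE

theorem outRate_eq_zero (hN : N.Acyclic) (e : E) {θ : ℝ} (h : T ≤ θ) :
    R.flow.outRate e θ = 0 :=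
  (R.terminatesBy.rates_eq_zero hN R.isIDE.1 R.horizon_nonneg (N.lt_lastPass_add_one_mul T)
    fun e _ h0 h1 => R.exists_inRate_const hN e h0 h1).1 e θ h

theorem inRate_eq_zero (hN : N.Acyclic) (e : E) {θ : ℝ}
    (h : (N.lastPass T : ℝ) * N.tauMin ≤ θ) : R.flow.inRate e θ = 0 :=
  have h' := N.le_add_transit e h
  (R.terminatesBy.rates_eq_zero hN R.isIDE.1 R.horizon_nonneg (N.lt_lastPass_add_one_mul T)
    fun e _ h0 h1 => R.exists_inRate_const hN e h0 h1).2 e θ h'.1 h'.2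

theorem queue_eq_zero (hN : N.Acyclic) (e : E) {θ : ℝ}
    (h : (N.lastPass T : ℝ) * N.tauMin ≤ θ) : N.queue R.flow e θ = 0 :=
  have h' := N.le_add_transit e h
  R.terminatesBy.queue_eq_zero hN R.isIDE.1 R.horizon_nonneg h'.1 h'.2

theorem cost_eq (hN : N.Acyclic) (e : E) {θ : ℝ}
    (h : (N.lastPass T : ℝ) * N.tauMin ≤ θ) : N.cost R.flow e θ = N.transit e := by
  simp [cost, R.queue_eq_zero hN e h]

/-- The break points control the flow up to the start of the last pass. From then on edge inflow
vanishes and all costs are the free travel times, so only this starting time itself has to be added.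
-/
theorem phaseTimes_subset (hN : N.Acyclic) {X : Finset ℝ}
    (hX : N.RegularUpTo R.flow X (R.horizon (N.lastPass T) 0)) :
    N.phaseTimes R.flow ⊆ insert ((N.lastPass T : ℝ) * N.tauMin) (X : Set ℝ) := by
  set κ := (N.lastPass T : ℝ) * N.tauMin with hκ
  have hhor : ∀ v, R.horizon (N.lastPass T) 0 v = κ := fun v => by simp [horizon, hκ]
  rintro θ ⟨hθ0, hθ⟩
  by_contra hmem
  rw [mem_insert_iff, not_or] at hmem
  obtain ⟨hne, hθX⟩ := hmem
  have hfree : ∀ u w, u < θ → θ < w → ∃ s t, u < s ∧ s < θ ∧ θ < t ∧ t < w ∧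
      ∀ x ∈ X, x ∉ Ioo s t := by
    intro u w hu hw
    have h1 : ((X : Set ℝ)ᶜ ∩ Ioo u w) ∈ 𝓝 θ :=
      inter_mem (X.finite_toSet.isClosed.isOpen_compl.mem_nhds hθX) (Ioo_mem_nhds hu hw)
    obtain ⟨s, t, ⟨hs, ht⟩, hsub⟩ := (mem_nhds_iff_exists_Ioo_subset).1 h1
    obtain ⟨s', hs'⟩ := exists_between (max_lt hs hu)
    obtain ⟨t', ht'⟩ := exists_between (lt_min ht hw)
    refine ⟨s', t', (le_max_right _ _).trans_lt hs'.1, hs'.2, ht'.1,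
      ht'.2.trans_le (min_le_right _ _), fun x hx hx' => ?_⟩
    exact (hsub ⟨((le_max_left _ _).trans_lt hs'.1).trans hx'.1,
      hx'.2.trans (ht'.2.trans_le (min_le_left _ _))⟩).1 hx
  have hconst : ∀ {α : Type _} {g : ℝ → α} {M : ℝ}, StepOn X M g → θ < M →
      ∀ᶠ y in 𝓝 θ, g y = g θ := by
    intro α g M hg hM
    obtain ⟨s, t, h1, h2, h3, h4, h5⟩ := hfree 0 M hθ0 hM
    filter_upwards [Ioo_mem_nhds h2 h3] with y hy
    have hst := hg s t h1.le (h2.trans h3) h4.le h5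
    rw [hst y ⟨hy.1.le, hy.2⟩, hst θ ⟨h2.le, h3⟩]
  refine hθ ?_
  -- Outflow may persist into the last pass, but only before `T`, which is less than one travel time
  -- after its start and thus still covered by `X`.
  have hout : ∀ e, ∀ᶠ y in 𝓝 θ, R.flow.outRate e y = R.flow.outRate e θ := by
    intro e
    by_cases h : θ ≤ T
    · refine hconst (hX.outRate e) ?_
      rw [hhor]
      have h1 := N.lt_lastPass_add_one_mul T
      have h2 := N.tauMin_le e
      linarith
    · filter_upwards [lt_mem_nhds (not_le.1 h)] with y hy
      rw [R.outRate_eq_zero hN e hy.le, R.outRate_eq_zero hN e (not_le.1 h).le]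
  have hin : ∀ e, ∀ᶠ y in 𝓝 θ, R.flow.inRate e y = R.flow.inRate e θ := by
    intro e
    rcases lt_or_gt_of_ne hne with h | h
    · exact hconst (hX.inRate e) (by rwa [hhor])
    · filter_upwards [lt_mem_nhds h] with y hy
      rw [R.inRate_eq_zero hN e hy.le, R.inRate_eq_zero hN e h.le]
  have hact : ∀ᶠ y in 𝓝 θ, N.activeEdges R.flow y = N.activeEdges R.flow θ := by
    rcases lt_or_gt_of_ne hne with h | h
    · obtain ⟨s, t, h1, h2, h3, h4, h5⟩ := hfree 0 κ hθ0 h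
      filter_upwards [Ioo_mem_nhds h2 h3] with y hy
      ext e
      exact hX.active e s t h1.le (by rw [hhor]; exact h4.le) h5 y hy θ ⟨h2, h3⟩
    · filter_upwards [lt_mem_nhds h] with y hy
      exact activeEdges_congr fun e => by rw [R.cost_eq hN e hy.le, R.cost_eq hN e h.le]
  filter_upwards [eventually_all.2 hin, eventually_all.2 hout, hact] with y h1 h2 h3
  rw [h3, funext h1, funext h2]

/-- Without flow and queues, projected travel times are constant, so no event can end a phase before
the pass ends. -/
theorem phases_lastPass (hN : N.Acyclic) {v : V} (hv : v ≠ N.sink) {I : ℝ × ℝ}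
    (hI : I ∈ R.phases v (N.lastPass T)) :
    I = ((N.lastPass T : ℝ) * N.tauMin, ((N.lastPass T : ℝ) + 1) * N.tauMin) := by
  have hΦ := R.isPhaseCover hv (le_refl (N.lastPass T))
  have hlt : (N.lastPass T : ℝ) * N.tauMin < ((N.lastPass T : ℝ) + 1) * N.tauMin := by
    linarith [N.tauMin_pos]
  have hgross : ∀ θ, (N.lastPass T : ℝ) * N.tauMin ≤ θ → N.grossInflow R.flow v θ = 0 := by
    intro θ hθ
    have h0 : 0 ≤ θ := (mul_nonneg (Nat.cast_nonneg _) N.tauMin_pos.le).trans hθ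
    have := R.isIDE.1.conservation v hv θ h0
    rw [Finset.sum_eq_zero fun e _ => R.inRate_eq_zero hN e hθ] at this
    unfold grossInflow
    linarith
  have hend : ∀ J ∈ R.phases v (N.lastPass T), J.2 = ((N.lastPass T : ℝ) + 1) * N.tauMin := by
    intro J hJ
    have hP := hΦ.maximal J hJ
    have hstart := hΦ.le_start J hJ
    by_contra hne
    have hlt' := lt_of_le_of_ne hP.le_end hne
    have hproj : ∀ e θ, J.1 ≤ θ →
        N.projTime R.flow e J.1 θ = N.projTime R.flow e J.1 J.1 := by
      intro e θ hθ
      have hq : ∀ y, J.1 ≤ y → N.projQueue R.flow e J.1 y = 0 := by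
        intro y hy
        unfold projQueue
        rw [R.queue_eq_zero hN e hstart, R.inRate_eq_zero hN e hstart]
        refine max_eq_left ?_
        have := mul_nonneg (N.cap_pos e).le (sub_nonneg.2 hy)
        linarith
      unfold projTime
      rw [hq θ hθ, hq J.1 le_rfl, label_congr (θ := θ) (θ' := J.1) fun e => by
        rw [R.cost_eq hN e (hstart.trans hθ), R.cost_eq hN e hstart]]
    refine hP.maximal _ hlt' le_rfl ⟨hP.can_keep.proper.trans hlt', ?_, ?_, ?_⟩
    · intro θ hθ
      rw [hgross θ (hstart.trans hθ.1), hgross J.1 hstart]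
    · intro e _ hpos
      rw [R.inRate_eq_zero hN e hstart] at hpos
      exact absurd hpos (lt_irrefl _)
    · intro θ hθ θ' hθ'
      unfold projActive
      simp only [hproj _ θ hθ.1.le, hproj _ θ' hθ'.1.le]
  obtain ⟨J, hJ, hJ1⟩ := hΦ.lo_mem hlt
  have hmem := hΦ.start_mem hI
  have : J = I := hΦ.eq_of_mem hJ hI (θ := I.1) ⟨hJ1.le.trans hmem.1, (hend J hJ).symm ▸ hmem.2⟩
    ⟨le_rfl, (hΦ.maximal I hI).can_keep.proper⟩
  rw [← this]
  exact Prod.ext hJ1 (hend J hJ)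

end AcyclicRun

end SingleSinkNetwork

theorem proposition3p3 :
    ∃ C : ℝ, 0 < C ∧
      ∀ (V E : Type*) [Fintype V] [Fintype E] [Nonempty E] (N : SingleSinkNetwork V E),
        N.Acyclic → ∀ (T : ℝ) (R : N.AcyclicRun T),
          ((N.phaseTimes R.flow).Finite ∧
            (N.numPhases R.flow : ℝ) ≤
              C * ((N.numInflowIntervals : ℝ) *
                (2 * ((N.maxOutDegree : ℝ) + 1) ^ (4 ^ N.maxOutDegree + 1)) ^
                  ((Fintype.card V : ℝ) * T / N.tauMin))) ∧
          (N.tauMin ≤ T →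
            R.localPhases.Finite ∧
            (R.localPhases.ncard : ℝ) ≤
              C * ((N.numInflowIntervals : ℝ) *
                (2 * ((N.maxOutDegree : ℝ) + 1) ^ (4 ^ N.maxOutDegree + 1)) ^
                  ((Fintype.card V : ℝ) * T / N.tauMin))) := by
  -- The induction bounds break points and phases before the last pass by `Q`; the second `Q` pays
  -- for the last pass, namely one extra break point, or one phase at each node.
  refine ⟨2, two_pos, ?_⟩
  intro V E _ _ _ N hN T R
  classical
  obtain ⟨X, L, hcard, hreg, hL⟩ := R.stageBound hN le_rfl
  rw [add_zero] at hcard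
  set Q : ℕ := N.numInflowIntervals * N.growthFactor ^ (Fintype.card V * N.lastPass T) with hQ
  have hG : 2 ≤ N.growthFactor := by
    unfold SingleSinkNetwork.growthFactor
    have : 0 < (N.maxOutDegree + 1) ^ (4 ^ N.maxOutDegree + 1) := by positivity
    omega
  have hP : 1 ≤ N.numInflowIntervals := by unfold SingleSinkNetwork.numInflowIntervals; omega
  have hGcast : (N.growthFactor : ℝ) =
      2 * ((N.maxOutDegree : ℝ) + 1) ^ (4 ^ N.maxOutDegree + 1) := by
    unfold SingleSinkNetwork.growthFactor; push_cast; rfl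
  rw [← hGcast]
  have hbound : (Q : ℝ) ≤ (N.numInflowIntervals : ℝ) *
      (N.growthFactor : ℝ) ^ ((Fintype.card V : ℝ) * T / N.tauMin) := by
    rw [hQ]
    push_cast
    refine mul_le_mul_of_nonneg_left ?_ (Nat.cast_nonneg _)
    rw [← Real.rpow_natCast]
    refine Real.rpow_le_rpow_of_exponent_le (by exact_mod_cast (by omega : 1 ≤ N.growthFactor)) ?_
    push_cast
    rw [mul_div_assoc]
    refine mul_le_mul_of_nonneg_left ?_ (Nat.cast_nonneg _)
    rw [le_div_iff₀ N.tauMin_pos]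
    exact N.lastPass_mul_le R.horizon_nonneg
  have hreduce : ∀ n : ℕ, n ≤ 2 * Q → (n : ℝ) ≤ 2 * ((N.numInflowIntervals : ℝ) *
      (N.growthFactor : ℝ) ^ ((Fintype.card V : ℝ) * T / N.tauMin)) := by
    intro n hn
    have : (n : ℝ) ≤ 2 * Q := by exact_mod_cast hn
    linarith
  refine ⟨?_, fun hT => ?_⟩
  · have hsub : N.phaseTimes R.flow ⊆
        ((insert ((N.lastPass T : ℝ) * N.tauMin) X : Finset ℝ) : Set ℝ) := by
      rw [Finset.coe_insert]
      exact R.phaseTimes_subset hN hreg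
    refine ⟨(Finset.finite_toSet _).subset hsub, hreduce _ ?_⟩
    have h1 := ncard_le_ncard hsub (Finset.finite_toSet _)
    rw [ncard_coe_finset] at h1
    have h2 := Finset.card_insert_le ((N.lastPass T : ℝ) * N.tauMin) X
    unfold SingleSinkNetwork.numPhases
    omega
  · have hsub : R.localPhases ⊆ ((L ∪ Finset.univ.image fun v : V => (v, N.lastPass T,
        (N.lastPass T : ℝ) * N.tauMin, ((N.lastPass T : ℝ) + 1) * N.tauMin) :
        Finset (V × ℕ × ℝ × ℝ)) : Set (V × ℕ × ℝ × ℝ)) := by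
      rintro ⟨v, k, I⟩ hx
      obtain ⟨hv, hk, hI⟩ := id hx
      simp only at hv hk hI
      rw [Finset.mem_coe, Finset.mem_union]
      rcases hk.lt_or_eq with h | h
      · exact Or.inl (hL _ hx (Or.inl h))
      · subst h
        refine Or.inr (Finset.mem_image.2 ⟨v, Finset.mem_univ v, ?_⟩)
        rw [R.phases_lastPass hN hv hI]
    refine ⟨(Finset.finite_toSet _).subset hsub, hreduce _ ?_⟩
    have h1 := ncard_le_ncard hsub (Finset.finite_toSet _)
    rw [ncard_coe_finset] at h1
    have h2 := (Finset.card_union_le L (Finset.univ.image fun v : V => (v, N.lastPass T,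
        (N.lastPass T : ℝ) * N.tauMin, ((N.lastPass T : ℝ) + 1) * N.tauMin))).trans
      (add_le_add le_rfl Finset.card_image_le)
    rw [Finset.card_univ] at h2
    -- Here `τ_min ≤ T` enters: without a preceding pass, `Q` would be just the number of inflow
    -- intervals and could not absorb one local phase per node.
    have hK : 1 ≤ N.lastPass T := by
      unfold SingleSinkNetwork.lastPass
      rwa [Nat.one_le_floor_iff, one_le_div N.tauMin_pos]
    have h3 : Fintype.card V ≤ Q := by
      calc Fintype.card V ≤ N.growthFactor ^ Fintype.card V :=
            (Nat.lt_pow_self (by omega)).le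
        _ ≤ N.growthFactor ^ (Fintype.card V * N.lastPass T) :=
            Nat.pow_le_pow_right (by omega) (Nat.le_mul_of_pos_right _ hK)
        _ ≤ Q := Nat.le_mul_of_pos_left _ hP
    omega
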